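/- **Setting.** A stream consists of triples $(q_i,k_i,v_i)\in(\mathbb R^d)^3$. Let $K_i,V_i\in\mathbb R^{i\times d}$ be the matrices with rows $k_1,\dots,k_i$ and $v_1,\dots,v_i$, and let $\mathrm{Attn}(q,K,V)=\mathrm{softmax}(Kq)^{T}V$; $\|V\|_2$ denotes the spectral norm. A randomized streaming algorithm updates a memory state on each triple and emits an estimate, using fresh random coins. It *uses $B$ bits* on a class of streams if the memory states that it reaches with positive probability on this class can be encoded injectively in $\{0,1\}^B$. A number has *$b$-bit precision* if it is $z/2^b$ with $z\in\mathbb Z$, $|z|\le 4^b$. **SubGen** with parameters $\delta>0$, $t,s\in\mathbb N$ keeps (i) a list of clusters, each with a center $x\in\mathbb R^d$, a counter $m$ and $t$ sampled keys, (ii) $\mu=\sum_i\|v_i\|_2^2$, (iii) $s$ sampled pairs (initially empty). On $(q,k,v)$: if the center nearest to $k$ is within distance $\delta$, its counter $m$ is increased by one and each of its $t$ samples is independently replaced by $k$ with probability $1/m$ (new $m$); otherwise a new cluster with center $k$, counter $1$ and $t$ copies of $k$ is opened. Each of the $s$ pairs is independently replaced by $(k,v)$ with probability $\|v\|_2^2/(\mu+\|v\|_2^2)$,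 and then $\mu$ is increased by $\|v\|_2^2$. The output is $z/\tau$ with $$z=\sum_{(k',v')}\frac{\mu}{s\|v'\|_2^2}e^{\langle q,k'\rangle}v',\qquad \tau=\sum_{\text{clusters}}\frac{m}{t}\sum_{\text{samples }k'}e^{\langle q,k'\rangle}.$$ Its space in words is the number of real coordinates and counters that it stores. **Theorem.** (1) *Upper bound.* There is an absolute constant $a>0$ such that for every sequence $r=r(n)=O(\log\log n)$ there are constants $C,c$ such that for every sequence $2\le d=d(n)=o(\log n)$, all sufficiently large $n$ and all $\varepsilon\in(0,1)$, SubGen with $\delta=e/3$, $t=\lceil a\,\varepsilon^{-2}e^{2\delta r}\log n\rceil$, $s=\lceil a\,\varepsilon^{-2}d\rceil$ satisfies the following. * For every $1\le i\le n$ and every stream of $i$ triples with all $\|k_l\|_2\le1$ and $\|q_l\|_2\le r$, its output $\widehat O_i$ after the $i$-th triple satisfies, with probability at least $0.99$, $$\|\widehat O_i-\mathrm{Attn}(q_i,K_i,V_i)\|_2\le\varepsilon\,\|\mathrm{softmax}(K_iq_i)\|_2\,\|V_i\|_2 .$$ * On every stream of at most $n$ triples with $\|k_l\|_2\le1$, whatever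 the coins, its space in words never exceeds $C\varepsilon^{-2}\,d e^d(\log n)^c=\varepsilon^{-2}\,\widetilde O(de^d)$. * For every $b\ge 0$, on streams of at most $n$ triples with $b$-bit precision and $\|k_l\|_2\le 1$, it uses at most $(b+1)\,C\varepsilon^{-2}\,d e^d(\log n)^c$ bits. (2) *Lower bound in the same dimension range.* There is an absolute constant $c'>0$ such that for every $\eta\in(0,1)$, every sequence $2\le d=d(n)=o(\log n)$, all sufficiently large $n$ and all $b\ge\log_2 n$: if a randomized streaming algorithm uses $B$ bits on the streams of at most $n$ triples with $b$-bit precision, keys of norm at most $1$ and nonnegative values, and on each such stream of length $n$ its last output $O$ satisfies, with probability at least $9/10$, $|O_j-Z_j|\le\eta Z_j$ for all $j\in[d]$, where $Z=\mathrm{Attn}(q_n,K_n,V_n)$, then $B\ge c'\,d e^d$. -/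

import Mathlib

open Filter Asymptotics
open scoped NNReal ENNReal Topology Matrix

noncomputable section

namespace KVCache

/-! ### Attention -/

/-- Vectors of `ℝ^d` with the Euclidean norm. -/
abbrev Vec (d : ℕ) := EuclideanSpace ℝ (Fin d)

/-- One entry `(q, k, v)` of the input stream. -/
structure Token (d : ℕ) where
  query : Vec d
  key : Vec d
  value : Vec d

/-- The matrix whose rows are the keys seen so far. -/
def keyMatrix {n d : ℕ} (x : Fin n → Token d) : Matrix (Fin n) (Fin d) ℝ :=
  Matrix.of fun i j => (x i).key j

/-- The matrix whose rows are the values seen so far. -/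
def valueMatrix {n d : ℕ} (x : Fin n → Token d) : Matrix (Fin n) (Fin d) ℝ :=
  Matrix.of fun i j => (x i).value j

def softmax {n : ℕ} (z : Fin n → ℝ) : Fin n → ℝ :=
  fun i => Real.exp (z i) / ∑ j, Real.exp (z j)

/-- `Attn(q, K, V) = softmax(K q)ᵀ V`. -/
def attn {n d : ℕ} (q : Vec d) (K V : Matrix (Fin n) (Fin d) ℝ) : Vec d :=
  WithLp.toLp 2 (softmax (K *ᵥ q.ofLp) ᵥ* V)

/-- The query of the last entry of a non-empty stream. -/
def lastQuery {n d : ℕ} (hn : 0 < n) (x : Fin n → Token d) : Vec d :=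
  (x ⟨n - 1, Nat.sub_lt hn one_pos⟩).query

/-- Attention of the last query with respect to all keys and values of the stream. -/
def lastAttn {n d : ℕ} (hn : 0 < n) (x : Fin n → Token d) : Vec d :=
  attn (lastQuery hn x) (keyMatrix x) (valueMatrix x)

/-- The Euclidean norm of `softmax (K q)`. -/
def softmaxNorm {n d : ℕ} (q : Vec d) (K : Matrix (Fin n) (Fin d) ℝ) : ℝ :=
  ‖(WithLp.toLp 2 (softmax (K *ᵥ q.ofLp)) : EuclideanSpace ℝ (Fin n))‖

open scoped Matrix.Norms.L2Operator in
/-- The spectral norm `‖V‖₂` of a matrix (operator norm between Euclidean spaces). -/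
def matrixSpectralNorm {n d : ℕ} (V : Matrix (Fin n) (Fin d) ℝ) : ℝ := ‖V‖

/-- `‖y - Attn(q_n, K_n, V_n)‖₂ ≤ ε ‖softmax(K_n q_n)‖₂ ‖V_n‖₂`. -/
def IsSpectralApprox {n d : ℕ} (ε : ℝ) (hn : 0 < n) (x : Fin n → Token d) (y : Vec d) : Prop :=
  ‖y - lastAttn hn x‖ ≤
    ε * softmaxNorm (lastQuery hn x) (keyMatrix x) * matrixSpectralNorm (valueMatrix x)

/-- `y` is a coordinatewise `(1 ± η)`-approximation of `z`. -/
def IsRelApprox {d : ℕ} (η : ℝ) (z y : Vec d) : Prop :=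
  ∀ j, |y j - z j| ≤ η * z j

/-! ### Randomized streaming algorithms and their memory -/

/-- A randomized streaming algorithm with memory states in `σ`: on each stream entry it updates
its memory and emits an estimate, using fresh random coins. -/
structure StreamAlg (d : ℕ) (σ : Type) where
  init : PMF σ
  step : σ → Token d → PMF (σ × Vec d)

/-- Joint law of the memory state and of the latest output after reading a list of entries
(the output before the first entry is `0` by convention). -/
def StreamAlg.run {d : ℕ} {σ : Type} (A : StreamAlg d σ) (l : List (Token d)) :
    PMF (σ × Vec d) :=
  l.foldl (fun p a => p.bind fun s => A.step s.1 a) (A.init.map fun s => (s, 0))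

/-- Probability that the output after reading all of `x` has the property `good`. -/
def StreamAlg.outputProb {d : ℕ} {σ : Type} (A : StreamAlg d σ) {n : ℕ} (x : Fin n → Token d)
    (good : Vec d → Prop) : ℝ≥0∞ :=
  (A.run (List.ofFn x)).toOuterMeasure {p | good p.2}

/-- The memory states that occur with positive probability on some stream of at most `n` entries
taken from `T`. -/
def StreamAlg.reachable {d : ℕ} {σ : Type} (A : StreamAlg d σ) (n : ℕ) (T : Set (Token d)) :
    Set σ :=
  {s | ∃ l : List (Token d), l.length ≤ n ∧ (∀ a ∈ l, a ∈ T) ∧ ∃ y, (s, y) ∈ (A.run l).support}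

/-- The memory of the algorithm can be kept in `B` bits on all streams of at most `n` entries
taken from `T`. -/
def StreamAlg.UsesBits {d : ℕ} {σ : Type} (A : StreamAlg d σ) (n : ℕ) (T : Set (Token d))
    (B : ℕ) : Prop :=
  ∃ enc : σ → (Fin B → Bool), Set.InjOn enc (A.reachable n T)

/-! ### The SubGen algorithm -/

/-- `m` independent coins, each `true` with probability `p`. -/
def coinFlips (m : ℕ) (p : ℝ≥0) (hp : p ≤ 1) : PMF (Fin m → Bool) :=
  PMF.ofFintype (fun b => ∏ j, if b j then (p : ℝ≥0∞) else 1 - (p : ℝ≥0∞)) (by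
    have hp' : (p : ℝ≥0∞) ≤ 1 := by exact_mod_cast hp
    have h := (Fintype.prod_sum (fun (_ : Fin m) (c : Bool) =>
      if c then (p : ℝ≥0∞) else 1 - (p : ℝ≥0∞)))
    rw [← h]
    simp [add_tsub_cancel_of_le hp'])

/-- A cluster of keys: its center, the number of keys assigned to it, and `t` reservoir samples
of these keys. -/
structure Cluster (d t : ℕ) where
  center : Vec d
  count : ℕ
  samples : Fin t → Vec d

/-- Memory of SubGen: the clusters, the squared mass `μ = ∑ ‖v_i‖²` of the values seen so far, and
`s` key-value pairs sampled with probability proportional to `‖v_i‖²`. -/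
structure SubGenState (d t s : ℕ) where
  clusters : List (Cluster d t)
  mass : ℝ≥0
  pairs : Fin s → Vec d × Vec d

/-- The empty memory. The pair `(0, 0)` stands for a slot that has not been filled yet. -/
def SubGenState.empty (d t s : ℕ) : SubGenState d t s := ⟨[], 0, fun _ => (0, 0)⟩

/-- Index of a cluster whose center is nearest to `k`, if there is any cluster. -/
def nearest {d t : ℕ} (D : List (Cluster d t)) (k : Vec d) : Option (Fin D.length) :=
  (List.finRange D.length).argmin fun i => ‖k - (D.get i).center‖

/-- Add the key `k` to a cluster: each of the `t` samples is independently replaced by `k` with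
probability `1 / (new count)`. -/
def Cluster.add {d t : ℕ} (c : Cluster d t) (k : Vec d) : PMF (Cluster d t) :=
  (coinFlips t (1 / ((c.count : ℝ≥0) + 1)) (div_le_one_of_le₀ (by simp) (by simp))).map fun b =>
    { center := c.center
      count := c.count + 1
      samples := fun j => if b j then k else c.samples j }

/-- Assign the key `k` to the nearest cluster if its center is within distance `δ`, otherwise open
a new cluster with center `k`. -/
def updateClusters {d t : ℕ} (δ : ℝ) (D : List (Cluster d t)) (k : Vec d) :
    PMF (List (Cluster d t)) :=
  match nearest D k with
  | some i =>
    if ‖k - (D.get i).center‖ ≤ δ then ((D.get i).add k).map fun c => D.set i c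
    else PMF.pure (D ++ [⟨k, 1, fun _ => k⟩])
  | none => PMF.pure (D ++ [⟨k, 1, fun _ => k⟩])

/-- Each of the `s` pairs is independently replaced by `(k, v)` with probability
`‖v‖² / (μ + ‖v‖²)` (no replacement when this is `0 / 0`). -/
def updatePairs {d s : ℕ} (μ : ℝ≥0) (M : Fin s → Vec d × Vec d) (k v : Vec d) :
    PMF (Fin s → Vec d × Vec d) :=
  (coinFlips s (‖v‖₊ ^ 2 / (μ + ‖v‖₊ ^ 2)) (div_le_one_of_le₀ (by simp) (by simp))).map
    fun b j => if b j then (k, v) else M j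

/-- The memory update of SubGen on a key-value pair. -/
def SubGenState.update {d t s : ℕ} (δ : ℝ) (S : SubGenState d t s) (k v : Vec d) :
    PMF (SubGenState d t s) :=
  (updateClusters δ S.clusters k).bind fun D =>
    (updatePairs S.mass S.pairs k v).map fun M => ⟨D, S.mass + ‖v‖₊ ^ 2, M⟩

/-- Estimate of `∑ exp ⟨q, k_i⟩ v_i`; unfilled slots contribute `0`. -/
def SubGenState.numerator {d t s : ℕ} (S : SubGenState d t s) (q : Vec d) : Vec d :=
  ∑ j, ((S.mass : ℝ) / (s * ‖(S.pairs j).2‖ ^ 2) * Real.exp (inner ℝ q (S.pairs j).1)) •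
    (S.pairs j).2

/-- Estimate of `∑ exp ⟨q, k_i⟩`. -/
def SubGenState.normalizer {d t s : ℕ} (S : SubGenState d t s) (q : Vec d) : ℝ :=
  (S.clusters.map fun c => (c.count : ℝ) / t * ∑ j, Real.exp (inner ℝ q (c.samples j))).sum

/-- The answer of SubGen to the query `q`. -/
def SubGenState.answer {d t s : ℕ} (S : SubGenState d t s) (q : Vec d) : Vec d :=
  (S.normalizer q)⁻¹ • S.numerator q

/-- The SubGen algorithm with cluster threshold `δ`, `t` samples per cluster and `s` sampled
key-value pairs. -/
def subGen (d t s : ℕ) (δ : ℝ) : StreamAlg d (SubGenState d t s) where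
  init := PMF.pure (SubGenState.empty d t s)
  step S a := (S.update δ a.key a.value).map fun S' => (S', S'.answer a.query)

/-- Number of memory words used by a state, one word per real coordinate or counter. -/
def SubGenState.words {d t s : ℕ} (S : SubGenState d t s) : ℕ :=
  S.clusters.length * (d + 1 + t * d) + 1 + s * (2 * d)

/-- Number of samples per cluster, `⌈a ε⁻² exp (2 δ r) log n⌉`. -/
def clusterSamples (a ε δ r : ℝ) (n : ℕ) : ℕ :=
  ⌈a * (ε ^ 2)⁻¹ * Real.exp (2 * δ * r) * Real.log n⌉₊

/-- Number of sampled key-value pairs, `⌈a ε⁻² d⌉`. -/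
def pairSamples (a ε : ℝ) (d : ℕ) : ℕ := ⌈a * (ε ^ 2)⁻¹ * d⌉₊

/-- SubGen with threshold `δ`, for streams of at most `n` entries, query norms at most `r` and
accuracy `ε`; `a` is the constant in the two sample sizes. -/
def tunedSubGen (a ε δ r : ℝ) (n d : ℕ) :
    StreamAlg d (SubGenState d (clusterSamples a ε δ r n) (pairSamples a ε d)) :=
  subGen d (clusterSamples a ε δ r n) (pairSamples a ε d) δ

/-! ### Finite precision -/

/-- All coordinates are signed binary numbers with `b` binary places and absolute value at most
`2 ^ b`. -/
def HasPrecision {d : ℕ} (b : ℕ) (u : Vec d) : Prop :=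
  ∀ j, ∃ z : ℤ, |z| ≤ 4 ^ b ∧ u j = z / 2 ^ b

/-- Entries with `b`-bit precision and key norm at most `1`. -/
def preciseTokens (d b : ℕ) : Set (Token d) :=
  {a | ‖a.key‖ ≤ 1 ∧ HasPrecision b a.query ∧ HasPrecision b a.key ∧ HasPrecision b a.value}

/-- The entries of `preciseTokens` whose value vector has no negative coordinate. -/
def preciseNonnegTokens (d b : ℕ) : Set (Token d) :=
  {a | a ∈ preciseTokens d b ∧ ∀ j, 0 ≤ a.value j}

end KVCache

end

/-!
The upper bound is a second moment computation. Fix a query `q` and let `f k = exp ⟨q, k⟩`. Both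
estimates of SubGen come from reservoirs: a sampled item of weight `ω` among total weight `μ`
contributes `μ / s` times its payload `u`, where `ω = ‖v‖ ^ 2`, `u = f k v / ‖v‖ ^ 2` for the pairs
and `ω = 1`, `u = f k` for the keys of one cluster. One update leaves the error of the estimate
unchanged on average, and the variance that it adds is at most `2 / s` times the mean growth of the
potential `(μ ^ 2 / s) ∑ ‖u‖ ^ 2` (`expect_reservoir_le`). So the mean square error is at most
`2 / s` times the mean potential.

For the numerator the potential has mean at most `(∑ ‖v‖ ^ 2) (∑ f ^ 2)`, and `∑ ‖v‖ ^ 2` is at most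
`d` times the squared spectral norm (`expect_numerator_error_le`, `exactMass_le`). For the
normalizer the samples of one cluster are within `2 δ` of each other, so their weights differ by a
factor of at most `exp (2 δ r)`, and the potential is at most `exp (2 δ r)` times the square of the
estimate itself (`sum_potential_le`, `expect_normalizer_error_le`). Chebyshev's inequality gives
the accuracy (`subGen_accuracy`).

For the space, the centers are points of the unit ball that are mutually more than `e / 3` apart.
Comparing volumes with disjoint balls of radius `e / 6` would give more than `e ^ d`. Balls of the
larger radius `ρ = 7 / 12` do overlap, but since at most ten such points lie in a ball of radius `ρ`
no point is covered more than ten times, and `(1 + ρ) / ρ ≤ e`. So there are at most `10 e ^ d`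
clusters (`card_le_of_separated`). With `b`-bit entries every stored number takes
`O(b + log n)` bits (`subGen_usesBits`).

The lower bound is the one-way index problem. Products of lattice points on the circle of radius
`√5` give `8 ^ (d / 2) ≥ e ^ (d - 1)` integer keys of equal norm with mutual inner products smaller
by at least one (`exists_integer_vectors`). A query along one of them, of length polylogarithmic
times `2 ^ d = n ^ o(1)`, makes its softmax weight dominate, so the attention reveals the `d` bits
stored under this key (`isRelApprox_readsAs`). Hence the memory before the query determines, for a
suitable outcome of the coins, `4 / 5` of the `8 ^ (d / 2)` symbols, and a counting argument bounds
the number of bits from below (`mul_le_of_index`).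
-/

noncomputable section

namespace KVCache

/-! ### Expectation under a finitely supported law -/

/-- The expectation of `f` under `p`. It is only used for laws `p` with finite support, where the
sum is finite. -/
def expect {α : Type*} (p : PMF α) (f : α → ℝ) : ℝ := ∑' a, (p a).toReal * f a

section Expect

variable {α β : Type*} {p : PMF α}

theorem expect_eq_sum (f : α → ℝ) {s : Finset α} (hs : ∀ a ∈ p.support, a ∈ s) :
    expect p f = ∑ a ∈ s, (p a).toReal * f a := by
  refine tsum_eq_sum fun a ha => ?_
  have : p a = 0 := by
    by_contra h
    exact ha (hs a ((PMF.mem_support_iff _ _).2 h))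
  simp [this]

theorem expect_mono (hp : p.support.Finite) {f g : α → ℝ} (h : ∀ a ∈ p.support, f a ≤ g a) :
    expect p f ≤ expect p g := by
  rw [expect_eq_sum (s := hp.toFinset) f (by simp), expect_eq_sum (s := hp.toFinset) g (by simp)]
  exact Finset.sum_le_sum fun a ha =>
    mul_le_mul_of_nonneg_left (h a (by simpa using ha)) ENNReal.toReal_nonneg

theorem expect_congr {f g : α → ℝ} (h : ∀ a ∈ p.support, f a = g a) :
    expect p f = expect p g := by
  refine tsum_congr fun a => ?_
  by_cases ha : a ∈ p.support
  · rw [h a ha]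
  · simp [(PMF.apply_eq_zero_iff p a).2 ha]

theorem expect_add (hp : p.support.Finite) (f g : α → ℝ) :
    expect p (fun a => f a + g a) = expect p f + expect p g := by
  simp only [expect_eq_sum (s := hp.toFinset) _ (by simp : ∀ a ∈ p.support, a ∈ hp.toFinset)]
  rw [← Finset.sum_add_distrib]
  exact Finset.sum_congr rfl fun a _ => by ring

theorem expect_const_mul (c : ℝ) (f : α → ℝ) :
    expect p (fun a => c * f a) = c * expect p f := by
  simp only [expect]
  rw [← tsum_mul_left]
  exact tsum_congr fun a => by ring

theorem expect_sub (hp : p.support.Finite) (f g : α → ℝ) :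
    expect p (fun a => f a - g a) = expect p f - expect p g := by
  have h : (fun a => f a - g a) = fun a => f a + (-1) * g a := by ext; ring
  rw [h, expect_add hp, expect_const_mul]; ring

theorem expect_const (c : ℝ) : expect p (fun _ => c) = c := by
  simp only [expect]
  rw [tsum_mul_right, ← ENNReal.tsum_toReal_eq (fun a => p.apply_ne_top a), p.tsum_coe]
  simp

theorem expect_nonneg {f : α → ℝ} (h : ∀ a, 0 ≤ f a) : 0 ≤ expect p f :=
  tsum_nonneg fun a => mul_nonneg ENNReal.toReal_nonneg (h a)

theorem expect_pure (a : α) (f : α → ℝ) : expect (PMF.pure a) f = f a := by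
  rw [expect_eq_sum (s := {a}) f (by simp)]
  simp

theorem support_bind_finite {q : α → PMF β} (hp : p.support.Finite)
    (hq : ∀ a ∈ p.support, (q a).support.Finite) : (p.bind q).support.Finite := by
  rw [PMF.support_bind]
  exact hp.biUnion hq

theorem support_map_finite (hp : p.support.Finite) (g : α → β) : (p.map g).support.Finite := by
  rw [PMF.support_map]
  exact hp.image g

theorem expect_bind {q : α → PMF β} (hp : p.support.Finite)
    (hq : ∀ a ∈ p.support, (q a).support.Finite) (f : β → ℝ) :
    expect (p.bind q) f = expect p fun a => expect (q a) f := by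
  have hb := support_bind_finite hp hq
  rw [expect_eq_sum (s := hb.toFinset) f (by simp), expect_eq_sum (s := hp.toFinset) _ (by simp)]
  have h1 : ∀ b, ((p.bind q) b).toReal = ∑ a ∈ hp.toFinset, (p a).toReal * (q a b).toReal := by
    intro b
    rw [PMF.bind_apply, tsum_eq_sum (s := hp.toFinset), ENNReal.toReal_sum]
    · simp
    · exact fun a _ => ENNReal.mul_ne_top (p.apply_ne_top a) ((q a).apply_ne_top b)
    · intro a ha
      rw [(PMF.apply_eq_zero_iff p a).2 (by simpa using ha), zero_mul]
  simp only [h1, Finset.sum_mul]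
  rw [Finset.sum_comm]
  refine Finset.sum_congr rfl fun a ha => ?_
  rw [expect_eq_sum (p := q a) (s := hb.toFinset) f, Finset.mul_sum]
  · exact Finset.sum_congr rfl fun b _ => by ring
  · intro b hb'
    rw [Set.Finite.mem_toFinset, PMF.mem_support_bind_iff]
    exact ⟨a, by simpa using ha, hb'⟩

theorem expect_map (hp : p.support.Finite) (g : α → β) (f : β → ℝ) :
    expect (p.map g) f = expect p fun a => f (g a) := by
  rw [PMF.map, expect_bind hp fun a _ => by simp [Function.comp]]
  simp [Function.comp, expect_pure]

/-- Markov's inequality. It also covers `A = 0`, where it says that a nonnegative variable of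
expectation `0` is almost surely `0`. -/
theorem measure_gt_le_of_expect_le (hp : p.support.Finite) {f : α → ℝ} (hf : ∀ a, 0 ≤ f a)
    {A κ : ℝ} (hA : 0 ≤ A) (hκ : 0 ≤ κ) (h : expect p f ≤ κ * A) :
    p.toOuterMeasure {a | A < f a} ≤ ENNReal.ofReal κ := by
  classical
  have hval : p.toOuterMeasure {a | A < f a} =
      ENNReal.ofReal (∑ a ∈ hp.toFinset with A < f a, (p a).toReal) := by
    rw [PMF.toOuterMeasure_apply, tsum_eq_sum (s := hp.toFinset),
      ENNReal.ofReal_sum_of_nonneg (fun _ _ => ENNReal.toReal_nonneg), Finset.sum_filter]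
    · refine Finset.sum_congr rfl fun a _ => ?_
      simp [Set.indicator_apply, ENNReal.ofReal_toReal (p.apply_ne_top a)]
    · intro a ha
      have : p a = 0 := (PMF.apply_eq_zero_iff p a).2 (by simpa using ha)
      simp [Set.indicator_apply, this]
  rw [hval]
  refine ENNReal.ofReal_le_ofReal ?_
  rw [expect_eq_sum (s := hp.toFinset) f (by simp)] at h
  have hle : ∑ a ∈ hp.toFinset with A < f a, (p a).toReal * f a ≤ κ * A :=
    (Finset.sum_le_sum_of_subset_of_nonneg (Finset.filter_subset _ _) fun a _ _ =>
      mul_nonneg ENNReal.toReal_nonneg (hf a)).trans h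
  rcases hA.eq_or_lt with rfl | hA
  · rw [mul_zero] at hle
    have h0 := (Finset.sum_eq_zero_iff_of_nonneg fun a _ =>
      mul_nonneg ENNReal.toReal_nonneg (hf a)).1
      (hle.antisymm (Finset.sum_nonneg fun a _ => mul_nonneg ENNReal.toReal_nonneg (hf a)))
    rw [Finset.sum_eq_zero]
    · exact hκ
    · intro a ha
      exact (mul_eq_zero.1 (h0 a ha)).resolve_right (Finset.mem_filter.1 ha).2.ne'
  · have h2 : (∑ a ∈ hp.toFinset with A < f a, (p a).toReal) * A ≤ κ * A := by
      refine le_trans ?_ hle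
      rw [Finset.sum_mul]
      exact Finset.sum_le_sum fun a ha =>
        mul_le_mul_of_nonneg_left (Finset.mem_filter.1 ha).2.le ENNReal.toReal_nonneg
    exact le_of_mul_le_mul_right h2 hA

end Expect

/-! ### Independent coins -/

theorem coinFlips_support_finite (m : ℕ) (p : ℝ≥0) (hp : p ≤ 1) :
    (coinFlips m p hp).support.Finite := Set.toFinite _

theorem expect_coinFlips {m : ℕ} {p : ℝ≥0} (hp : p ≤ 1) (F : (Fin m → Bool) → ℝ) :
    expect (coinFlips m p hp) F =
      ∑ b, (∏ j, if b j then (p : ℝ) else 1 - (p : ℝ)) * F b := by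
  rw [expect_eq_sum (s := Finset.univ) F (by simp)]
  refine Finset.sum_congr rfl fun b _ => ?_
  congr 1
  have hp' : (p : ℝ≥0∞) ≤ 1 := by exact_mod_cast hp
  rw [coinFlips, PMF.ofFintype_apply, ENNReal.toReal_prod]
  refine Finset.prod_congr rfl fun j _ => ?_
  split_ifs
  · simp
  · rw [ENNReal.toReal_sub_of_le hp' ENNReal.one_ne_top]; simp

theorem expect_coinFlips_succ {m : ℕ} {p : ℝ≥0} (hp : p ≤ 1) (F : (Fin (m + 1) → Bool) → ℝ) :
    expect (coinFlips (m + 1) p hp) F =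
      p * expect (coinFlips m p hp) (fun b => F (Fin.cons true b)) +
        (1 - p) * expect (coinFlips m p hp) (fun b => F (Fin.cons false b)) := by
  simp only [expect_coinFlips]
  rw [← (Fin.consEquiv fun _ => Bool).sum_comp, Fintype.sum_prod_type, Fintype.sum_bool,
    Finset.mul_sum, Finset.mul_sum]
  congr 1 <;>
  · refine Finset.sum_congr rfl fun b _ => ?_
    simp [Fin.consEquiv, Fin.prod_univ_succ, mul_assoc]

/-- The mean of a sum of slots that are independently overwritten with probability `p`. -/
theorem expect_coinFlips_sum {m : ℕ} {p : ℝ≥0} (hp : p ≤ 1) (x : ℝ) (y : Fin m → ℝ) :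
    expect (coinFlips m p hp) (fun b => ∑ j, if b j then x else y j) =
      ∑ j, (p * x + (1 - p) * y j) := by
  induction m with
  | zero => simpa using expect_const (p := coinFlips 0 p hp) 0
  | succ m ih =>
    rw [expect_coinFlips_succ]
    simp only [Fin.sum_univ_succ, Fin.cons_zero, Fin.cons_succ, if_true, Bool.false_eq_true,
      if_false]
    rw [expect_add (coinFlips_support_finite _ _ _), expect_add (coinFlips_support_finite _ _ _),
      expect_const, expect_const, ih]
    ring

/-- Bias-variance decomposition for a sum of slots that are independently overwritten with
probability `p`. -/
theorem expect_coinFlips_norm_sq {E : Type*} [NormedAddCommGroup E] [InnerProductSpace ℝ E]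
    {m : ℕ} {p : ℝ≥0} (hp : p ≤ 1) (x c : E) (y : Fin m → E) :
    expect (coinFlips m p hp) (fun b => ‖(∑ j, if b j then x else y j) - c‖ ^ 2) =
      ‖∑ j, ((p : ℝ) • x + (1 - (p : ℝ)) • y j) - c‖ ^ 2 +
        p * (1 - p) * ∑ j, ‖x - y j‖ ^ 2 := by
  induction m generalizing c with
  | zero => simpa using expect_const (p := coinFlips 0 p hp) (‖c‖ ^ 2)
  | succ m ih =>
    have key : ∀ u v w : E, (p : ℝ) * ‖u - w‖ ^ 2 + (1 - p) * ‖v - w‖ ^ 2 =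
        ‖(p : ℝ) • u + (1 - (p : ℝ)) • v - w‖ ^ 2 + p * (1 - p) * ‖u - v‖ ^ 2 := by
      intro u v w
      have : (p : ℝ) • u + (1 - (p : ℝ)) • v - w =
          (p : ℝ) • (u - w) + (1 - (p : ℝ)) • (v - w) := by module
      rw [this, ← sub_sub_sub_cancel_right u v w, norm_add_sq_real,
        norm_sub_sq_real (u - w) (v - w), norm_smul, norm_smul, inner_smul_left, inner_smul_right,
        mul_pow, mul_pow]
      simp only [Real.norm_eq_abs, sq_abs, conj_trivial]
      ring
    rw [expect_coinFlips_succ]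
    simp only [Fin.sum_univ_succ, Fin.cons_zero, Fin.cons_succ, if_true, Bool.false_eq_true,
      if_false]
    have h : ∀ (z : E) (b : Fin m → Bool), (z + ∑ j, if b j then x else y j.succ) - c =
        (∑ j, if b j then x else y j.succ) - (c - z) := fun z b => by abel
    simp only [h]
    rw [ih, ih]
    set S := ∑ j : Fin m, ((p : ℝ) • x + (1 - (p : ℝ)) • y j.succ)
    have h1 : ∀ z, S - (c - z) = z - (c - S) := fun z => by abel
    have h2 : (p : ℝ) • x + (1 - (p : ℝ)) • y 0 + S - c =
      (p : ℝ) • x + (1 - (p : ℝ)) • y 0 - (c - S) := by abel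
    rw [h1, h1, h2]
    linear_combination key x (y 0) (c - S)

/-! ### One step of weighted reservoir sampling -/

/-- The slots of a reservoir of total weight `μ` hold payloads `u j`; an item of weight `ω` and
payload `x` arrives. The sampled mean square grows in expectation by exactly `ω ‖x‖ ^ 2`. -/
theorem expect_reservoir_sq {E : Type*} [NormedAddCommGroup E] {s : ℕ} (hs : 0 < s)
    (μ ω : ℝ≥0) (hp : ω / (μ + ω) ≤ 1) (x : E) (u : Fin s → E) :
    expect (coinFlips s (ω / (μ + ω)) hp)
        (fun b => ((μ : ℝ) + ω) / s * ∑ j, ‖if b j then x else u j‖ ^ 2) =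
      (μ : ℝ) / s * ∑ j, ‖u j‖ ^ 2 + ω * ‖x‖ ^ 2 := by
  have h1 : ∀ b : Fin s → Bool, ∑ j, ‖if b j then x else u j‖ ^ 2 =
      ∑ j, if b j then ‖x‖ ^ 2 else ‖u j‖ ^ 2 := fun b =>
    Finset.sum_congr rfl fun j _ => by split_ifs <;> rfl
  simp only [h1]
  rw [expect_const_mul, expect_coinFlips_sum, Finset.sum_add_distrib, ← Finset.mul_sum,
    ← Finset.mul_sum]
  have hs' : (s : ℝ) ≠ 0 := by positivity
  simp only [Finset.sum_const, Finset.card_univ, Fintype.card_fin, nsmul_eq_mul]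
  push_cast
  -- if the total weight is `0`, the replacement probability is `0 / 0 = 0` and both sides vanish
  rcases eq_or_ne ((μ : ℝ) + ω) 0 with h0 | h0
  · have hμ : (μ : ℝ) = 0 := le_antisymm (by linarith [ω.2, h0]) μ.2
    have hω : (ω : ℝ) = 0 := by linarith
    simp [hμ, hω]
  · field_simp
    ring

/-- The supermartingale behind both estimators of SubGen. In the situation of
`expect_reservoir_sq`, `(μ / s) ∑ u j` estimates a sum `c` that grows by `ω x`. Its squared error
minus `2 / s` times the potential `(μ ^ 2 / s) ∑ ‖u j‖ ^ 2` does not grow in expectation. -/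
theorem expect_reservoir_le {E : Type*} [NormedAddCommGroup E] [InnerProductSpace ℝ E] {s : ℕ}
    (hs : 0 < s) (μ ω : ℝ≥0) (hp : ω / (μ + ω) ≤ 1) (x c : E)
    (u : Fin s → E) :
    expect (coinFlips s (ω / (μ + ω)) hp)
        (fun b => ‖(((μ : ℝ) + ω) / s) • (∑ j, if b j then x else u j) - (c + (ω : ℝ) • x)‖ ^ 2 -
          2 / s * (((μ : ℝ) + ω) ^ 2 / s * ∑ j, ‖if b j then x else u j‖ ^ 2)) ≤
      ‖((μ : ℝ) / s) • ∑ j, u j - c‖ ^ 2 - 2 / s * ((μ : ℝ) ^ 2 / s * ∑ j, ‖u j‖ ^ 2) := by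
  have hs' : (s : ℝ) ≠ 0 := by positivity
  have hs0 : (0 : ℝ) < s := by positivity
  set p := ω / (μ + ω) with hpdef
  have hpω : (p : ℝ) * (μ + ω) = ω ∧ (1 - (p : ℝ)) * (μ + ω) = μ := by
    rw [hpdef]; push_cast
    rcases eq_or_ne ((μ : ℝ) + ω) 0 with h0 | h0
    · have hμ : (μ : ℝ) = 0 := le_antisymm (by linarith [ω.2, h0]) μ.2
      have hω : (ω : ℝ) = 0 := by linarith
      simp [hμ, hω]
    · constructor <;> field_simp
      ring
  rw [expect_sub (coinFlips_support_finite _ _ _)]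
  have e1 : ∀ b : Fin s → Bool, (((μ : ℝ) + ω) / s) • (∑ j, if b j then x else u j) =
      ∑ j, if b j then (((μ : ℝ) + ω) / s) • x else (((μ : ℝ) + ω) / s) • u j := by
    intro b
    rw [Finset.smul_sum]
    exact Finset.sum_congr rfl fun j _ => by split_ifs <;> rfl
  have e2 : ∀ b : Fin s → Bool,
      2 / (s : ℝ) * (((μ : ℝ) + ω) ^ 2 / s * ∑ j, ‖if b j then x else u j‖ ^ 2) =
      2 / s * ((μ : ℝ) + ω) * (((μ : ℝ) + ω) / s * ∑ j, ‖if b j then x else u j‖ ^ 2) :=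
    fun b => by ring
  simp only [e1, e2]
  rw [expect_coinFlips_norm_sq, expect_const_mul, expect_reservoir_sq hs]
  -- the estimator is unbiased
  have e3 : ∑ j, ((p : ℝ) • (((μ : ℝ) + ω) / s) • x + (1 - (p : ℝ)) • (((μ : ℝ) + ω) / s) • u j) -
      (c + (ω : ℝ) • x) = ((μ : ℝ) / s) • ∑ j, u j - c := by
    rw [Finset.sum_add_distrib, Finset.sum_const, Finset.card_univ, Fintype.card_fin,
      Finset.smul_sum, ← Nat.cast_smul_eq_nsmul ℝ]
    have h1 : (s : ℝ) • (p : ℝ) • (((μ : ℝ) + ω) / s) • x = (ω : ℝ) • x := by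
      rw [smul_smul, smul_smul]
      congr 1
      calc (s : ℝ) * p * ((μ + ω) / s) = p * (μ + ω) := by field_simp
        _ = ω := hpω.1
    have h2 : ∀ j, (1 - (p : ℝ)) • (((μ : ℝ) + ω) / s) • u j = ((μ : ℝ) / s) • u j := by
      intro j
      rw [smul_smul]
      congr 1
      rw [← mul_div_assoc, hpω.2]
    rw [h1]; simp only [h2]; abel
  rw [e3]
  have e4 : ∑ j, ‖(((μ : ℝ) + ω) / s) • x - (((μ : ℝ) + ω) / s) • u j‖ ^ 2 ≤
      (((μ : ℝ) + ω) / s) ^ 2 * (2 * (s * ‖x‖ ^ 2 + ∑ j, ‖u j‖ ^ 2)) := by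
    have : (s : ℝ) * ‖x‖ ^ 2 + ∑ j, ‖u j‖ ^ 2 = ∑ j, (‖x‖ ^ 2 + ‖u j‖ ^ 2) := by
      simp [Finset.sum_add_distrib]
    rw [this, Finset.mul_sum, Finset.mul_sum]
    refine Finset.sum_le_sum fun j _ => ?_
    rw [← smul_sub, norm_smul, mul_pow, Real.norm_eq_abs, sq_abs]
    refine mul_le_mul_of_nonneg_left ?_ (sq_nonneg _)
    have := parallelogram_law_with_norm ℝ x (u j)
    nlinarith [norm_nonneg (x + u j)]
  have hp1 : (0 : ℝ) ≤ 1 - p := by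
    have : (p : ℝ) ≤ 1 := by exact_mod_cast hp
    linarith
  have e5 := mul_le_mul_of_nonneg_left e4 (mul_nonneg p.2 hp1)
  have e6 : (p : ℝ) * (1 - p) * ((((μ : ℝ) + ω) / s) ^ 2 * (2 * (s * ‖x‖ ^ 2 + ∑ j, ‖u j‖ ^ 2))) =
      2 / s * (μ * ω * ‖x‖ ^ 2 + ω * (μ / s * ∑ j, ‖u j‖ ^ 2)) := by
    have : (p : ℝ) * (1 - p) * ((((μ : ℝ) + ω) / s) ^ 2 * (2 * (s * ‖x‖ ^ 2 + ∑ j, ‖u j‖ ^ 2))) =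
      ((p : ℝ) * (μ + ω)) * ((1 - p) * (μ + ω)) / s ^ 2 *
        (2 * (s * ‖x‖ ^ 2 + ∑ j, ‖u j‖ ^ 2)) := by ring
    rw [this, hpω.1, hpω.2]
    field_simp
  rw [NNReal.val_eq_coe, e6] at e5
  have e7 : 0 ≤ 2 / (s : ℝ) * ((ω : ℝ) * ω * ‖x‖ ^ 2) := by positivity
  have e8 : 2 / (s : ℝ) * (μ + ω) * (μ / s * ∑ j, ‖u j‖ ^ 2 + ω * ‖x‖ ^ 2) =
      2 / s * (μ ^ 2 / s * ∑ j, ‖u j‖ ^ 2) +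
      2 / s * (μ * ω * ‖x‖ ^ 2 + ω * (μ / s * ∑ j, ‖u j‖ ^ 2)) +
      2 / s * (ω * ω * ‖x‖ ^ 2) := by ring
  linarith

/-! ### Runs of streaming algorithms -/

section Run

variable {d : ℕ} {σ : Type} (A : StreamAlg d σ)

theorem StreamAlg.run_append_singleton (l : List (Token d)) (a : Token d) :
    A.run (l ++ [a]) = (A.run l).bind fun s => A.step s.1 a := by
  simp [StreamAlg.run, List.foldl_append]

theorem StreamAlg.run_nil : A.run [] = A.init.map fun s => (s, 0) := rfl

theorem StreamAlg.run_support_finite (h0 : A.init.support.Finite)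
    (h1 : ∀ s a, (A.step s a).support.Finite) (l : List (Token d)) :
    (A.run l).support.Finite := by
  induction l using List.reverseRecOn with
  | nil => exact support_map_finite h0 _
  | append_singleton l a ih =>
    rw [A.run_append_singleton]
    exact support_bind_finite ih fun s _ => h1 _ _

/-- A property of the memory that holds initially and is preserved by every step holds throughout
the run. -/
theorem StreamAlg.run_invariant {P : List (Token d) → σ → Prop}
    (h0 : ∀ s ∈ A.init.support, P [] s)
    (h1 : ∀ l a s, P l s → ∀ x ∈ (A.step s a).support, P (l ++ [a]) x.1)
    (l : List (Token d)) : ∀ x ∈ (A.run l).support, P l x.1 := by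
  induction l using List.reverseRecOn with
  | nil =>
    intro x hx
    rw [A.run_nil, PMF.support_map] at hx
    obtain ⟨s, hs, rfl⟩ := hx
    exact h0 s hs
  | append_singleton l a ih =>
    intro x hx
    rw [A.run_append_singleton, PMF.mem_support_bind_iff] at hx
    obtain ⟨y, hy, hx⟩ := hx
    exact h1 l a y.1 (ih y hy) x hx

/-- A function of the memory whose expectation does not grow in any step, given the invariant `P`,
has at the end at most its initial expectation. -/
theorem StreamAlg.expect_run_le (hf0 : A.init.support.Finite)
    (hf1 : ∀ s a, (A.step s a).support.Finite) {P : List (Token d) → σ → Prop}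
    (h0 : ∀ s ∈ A.init.support, P [] s)
    (h1 : ∀ l a s, P l s → ∀ x ∈ (A.step s a).support, P (l ++ [a]) x.1)
    (Φ : List (Token d) → σ → ℝ)
    (hΦ : ∀ l a s, P l s → expect (A.step s a) (fun x => Φ (l ++ [a]) x.1) ≤ Φ l s)
    (l : List (Token d)) : expect (A.run l) (fun x => Φ l x.1) ≤ expect A.init (Φ []) := by
  induction l using List.reverseRecOn with
  | nil => rw [A.run_nil, expect_map hf0]
  | append_singleton l a ih =>
    have hfin := A.run_support_finite hf0 hf1 l
    rw [A.run_append_singleton, expect_bind hfin fun s _ => hf1 _ _]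
    exact (expect_mono hfin fun x hx => hΦ l a x.1 (A.run_invariant h0 h1 l x hx)).trans ih

end Run

/-! ### The memory law of SubGen -/

theorem nearest_eq_some {d t : ℕ} {D : List (Cluster d t)} {k : Vec d} {i : Fin D.length}
    (h : nearest D k = some i) (j : Fin D.length) :
    ‖k - (D.get i).center‖ ≤ ‖k - (D.get j).center‖ :=
  List.le_of_mem_argmin (f := fun i => ‖k - (D.get i).center‖) (List.mem_finRange j) h

theorem nearest_eq_none {d t : ℕ} {D : List (Cluster d t)} {k : Vec d} (h : nearest D k = none) :
    D = [] := by
  have := List.argmin_eq_none.1 h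
  rwa [List.finRange_eq_nil_iff, List.length_eq_zero_iff] at this

/-- The cluster list can change in two ways: a new cluster is opened far from
all centers, or a nearby cluster absorbs the key. -/
theorem updateClusters_cases {d t : ℕ} (δ : ℝ) (D : List (Cluster d t)) (k : Vec d) :
    ((∀ c ∈ D, δ < ‖k - c.center‖) ∧
      updateClusters δ D k = PMF.pure (D ++ [⟨k, 1, fun _ => k⟩])) ∨
    ∃ i : Fin D.length, ‖k - (D.get i).center‖ ≤ δ ∧
      updateClusters δ D k = ((D.get i).add k).map fun c => D.set i c := by
  unfold updateClusters
  cases h : nearest D k with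
  | none =>
    left
    rw [nearest_eq_none h]
    simp
  | some i =>
    by_cases hi : ‖k - (D.get i).center‖ ≤ δ
    · right
      exact ⟨i, hi, by simp only [if_pos hi]⟩
    · left
      refine ⟨fun c hc => ?_, by simp only [if_neg hi]⟩
      obtain ⟨j, rfl⟩ := List.mem_iff_get.1 hc
      exact (not_le.1 hi).trans_le (nearest_eq_some h j)

theorem Cluster.add_support_finite {d t : ℕ} (c : Cluster d t) (k : Vec d) :
    (c.add k).support.Finite := support_map_finite (coinFlips_support_finite _ _ _) _

theorem updateClusters_support_finite {d t : ℕ} (δ : ℝ) (D : List (Cluster d t)) (k : Vec d) :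
    (updateClusters δ D k).support.Finite := by
  rcases updateClusters_cases δ D k with ⟨-, h⟩ | ⟨i, -, h⟩
  · rw [h, PMF.support_pure]; exact Set.finite_singleton _
  · rw [h]; exact support_map_finite (Cluster.add_support_finite _ _) _

theorem updatePairs_support_finite {d s : ℕ} (μ : ℝ≥0) (M : Fin s → Vec d × Vec d) (k v : Vec d) :
    (updatePairs μ M k v).support.Finite := support_map_finite (coinFlips_support_finite _ _ _) _

theorem SubGenState.update_support_finite {d t s : ℕ} (δ : ℝ) (S : SubGenState d t s)
    (k v : Vec d) : (S.update δ k v).support.Finite :=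
  support_bind_finite (updateClusters_support_finite _ _ _) fun _ _ =>
    support_map_finite (updatePairs_support_finite _ _ _ _) _

theorem subGen_init_support_finite {d t s : ℕ} (δ : ℝ) :
    (subGen d t s δ).init.support.Finite := by
  simp [subGen]

theorem subGen_step_support_finite {d t s : ℕ} (δ : ℝ) (S : SubGenState d t s) (a : Token d) :
    ((subGen d t s δ).step S a).support.Finite :=
  support_map_finite (S.update_support_finite _ _ _) _

theorem subGen_run_support_finite {d t s : ℕ} (δ : ℝ) (l : List (Token d)) :
    ((subGen d t s δ).run l).support.Finite :=
  StreamAlg.run_support_finite _ (subGen_init_support_finite δ) (subGen_step_support_finite δ) l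

/-- What a step of SubGen can lead to. -/
theorem mem_support_subGen_step {d t s : ℕ} {δ : ℝ} {S : SubGenState d t s} {a : Token d}
    {x : SubGenState d t s × Vec d} (hx : x ∈ ((subGen d t s δ).step S a).support) :
    x.2 = x.1.answer a.query ∧ x.1.mass = S.mass + ‖a.value‖₊ ^ 2 ∧
    (∀ j, x.1.pairs j = (a.key, a.value) ∨ x.1.pairs j = S.pairs j) ∧
    (((∀ c ∈ S.clusters, δ < ‖a.key - c.center‖) ∧
      x.1.clusters = S.clusters ++ [⟨a.key, 1, fun _ => a.key⟩]) ∨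
    ∃ i : Fin S.clusters.length, ‖a.key - (S.clusters.get i).center‖ ≤ δ ∧
      ∃ b : Fin t → Bool, x.1.clusters = S.clusters.set i
        ⟨(S.clusters.get i).center, (S.clusters.get i).count + 1,
          fun j => if b j then a.key else (S.clusters.get i).samples j⟩) := by
  simp only [subGen, PMF.support_map, SubGenState.update, PMF.support_bind, Set.mem_image,
    Set.mem_iUnion] at hx
  obtain ⟨S', ⟨D, hD, M, hM, rfl⟩, rfl⟩ := hx
  refine ⟨rfl, rfl, ?_, ?_⟩
  · simp only [updatePairs, PMF.support_map, Set.mem_image] at hM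
    obtain ⟨b, -, rfl⟩ := hM
    intro j
    by_cases hb : b j <;> simp [hb]
  · rcases updateClusters_cases δ S.clusters a.key with ⟨h1, h⟩ | ⟨i, h1, h⟩
    · left
      rw [h, PMF.support_pure] at hD
      exact ⟨h1, hD⟩
    · right
      rw [h] at hD
      simp only [Cluster.add, PMF.support_map, Set.mem_image] at hD
      obtain ⟨c, ⟨b, -, rfl⟩, rfl⟩ := hD
      exact ⟨i, h1, b, rfl⟩

theorem expect_subGen_step {d t s : ℕ} (δ : ℝ) (S : SubGenState d t s) (a : Token d)
    (g : SubGenState d t s → ℝ) :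
    expect ((subGen d t s δ).step S a) (fun x => g x.1) =
      expect (updateClusters δ S.clusters a.key) fun D =>
        expect (updatePairs S.mass S.pairs a.key a.value) fun M =>
          g ⟨D, S.mass + ‖a.value‖₊ ^ 2, M⟩ := by
  rw [subGen, expect_map (S.update_support_finite _ _ _), SubGenState.update,
    expect_bind (updateClusters_support_finite _ _ _) fun _ _ =>
      support_map_finite (updatePairs_support_finite _ _ _ _) _]
  refine expect_congr fun D _ => ?_
  rw [expect_map (updatePairs_support_finite _ _ _ _)]

/-! ### Accuracy of the sampled pairs -/

/-- The weight `exp ⟨q, k⟩` of the key `k` for the query `q`. -/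
def keyWeight {d : ℕ} (q k : Vec d) : ℝ := Real.exp (inner ℝ q k)

theorem keyWeight_pos {d : ℕ} (q k : Vec d) : 0 < keyWeight q k := Real.exp_pos _

/-- The contribution of a sampled pair to the numerator of SubGen, up to the factor `μ / s`. -/
def pairPayload {d : ℕ} (q : Vec d) (x : Vec d × Vec d) : Vec d :=
  (keyWeight q x.1 / ‖x.2‖ ^ 2) • x.2

theorem SubGenState.numerator_eq {d t s : ℕ} (S : SubGenState d t s) (q : Vec d) :
    S.numerator q = ((S.mass : ℝ) / s) • ∑ j, pairPayload q (S.pairs j) := by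
  rw [SubGenState.numerator, Finset.smul_sum]
  refine Finset.sum_congr rfl fun j _ => ?_
  rw [pairPayload, smul_smul]
  congr 1
  rw [keyWeight, div_mul_eq_div_div]
  ring

theorem normSq_smul_pairPayload {d : ℕ} (q k v : Vec d) :
    ((‖v‖₊ ^ 2 : ℝ≥0) : ℝ) • pairPayload q (k, v) = keyWeight q k • v := by
  rcases eq_or_ne v 0 with rfl | hv
  · simp [pairPayload]
  · rw [pairPayload, smul_smul]
    congr 1
    have : ‖v‖ ≠ 0 := norm_ne_zero_iff.2 hv
    push_cast
    field_simp

theorem normSq_mul_pairPayload_le {d : ℕ} (q k v : Vec d) :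
    ((‖v‖₊ ^ 2 : ℝ≥0) : ℝ) * ‖pairPayload q (k, v)‖ ^ 2 ≤ keyWeight q k ^ 2 := by
  rcases eq_or_ne v 0 with rfl | hv
  · simp [sq_nonneg]
  · have : ‖v‖ ≠ 0 := norm_ne_zero_iff.2 hv
    rw [pairPayload, norm_smul, mul_pow]
    simp only [norm_div, norm_pow, Real.norm_eq_abs, div_pow, sq_abs]
    push_cast
    apply le_of_eq
    field_simp

/-- `∑ exp ⟨q, k⟩ v` over a stream. -/
def exactNumerator {d : ℕ} (q : Vec d) (l : List (Token d)) : Vec d :=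
  (l.map fun a => keyWeight q a.key • a.value).sum

/-- `∑ exp ⟨q, k⟩` over a stream. -/
def exactNormalizer {d : ℕ} (q : Vec d) (l : List (Token d)) : ℝ :=
  (l.map fun a => keyWeight q a.key).sum

/-- `∑ exp ⟨q, k⟩ ^ 2` over a stream. -/
def exactSquares {d : ℕ} (q : Vec d) (l : List (Token d)) : ℝ :=
  (l.map fun a => keyWeight q a.key ^ 2).sum

/-- `∑ ‖v‖ ^ 2` over a stream. -/
def exactMass {d : ℕ} (l : List (Token d)) : ℝ≥0 := (l.map fun a => ‖a.value‖₊ ^ 2).sum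

theorem subGen_mass_eq {d t s : ℕ} (δ : ℝ) (l : List (Token d)) :
    ∀ x ∈ ((subGen d t s δ).run l).support, x.1.mass = exactMass l := by
  refine StreamAlg.run_invariant _ (P := fun l (S : SubGenState d t s) => S.mass = exactMass l)
    ?_ ?_ l
  · intro S hS
    simp only [subGen, PMF.support_pure, Set.mem_singleton_iff] at hS
    simp [hS, SubGenState.empty, exactMass]
  · intro l a S hS x hx
    rw [(mem_support_subGen_step hx).2.1, hS]
    simp [exactMass]

theorem expect_updatePairs {d s : ℕ} (μ : ℝ≥0) (M : Fin s → Vec d × Vec d) (k v : Vec d)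
    (g : (Fin s → Vec d × Vec d) → ℝ) :
    expect (updatePairs μ M k v) g =
      expect (coinFlips s (‖v‖₊ ^ 2 / (μ + ‖v‖₊ ^ 2)) (div_le_one_of_le₀ (by simp) (by simp)))
        fun b => g fun j => if b j then (k, v) else M j :=
  expect_map (coinFlips_support_finite _ _ _) _ _

theorem pairPayload_ite {d : ℕ} (q : Vec d) (b : Bool) (x y : Vec d × Vec d) :
    pairPayload q (if b then x else y) = if b then pairPayload q x else pairPayload q y := by
  split_ifs <;> rfl

/-- The second moment of the numerator's sample, which controls its variance. -/
theorem expect_pairs_sq_le {d t s : ℕ} (hs : 0 < s) (δ : ℝ) (q : Vec d) (l : List (Token d)) :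
    expect ((subGen d t s δ).run l)
        (fun x => (x.1.mass : ℝ) / s * ∑ j, ‖pairPayload q (x.1.pairs j)‖ ^ 2) ≤
      exactSquares q l := by
  have h := StreamAlg.expect_run_le (subGen d t s δ) (subGen_init_support_finite δ)
    (subGen_step_support_finite δ) (P := fun _ _ => True) (fun _ _ => trivial)
    (fun _ _ _ _ _ _ => trivial)
    (fun l (S : SubGenState d t s) =>
      (S.mass : ℝ) / s * ∑ j, ‖pairPayload q (S.pairs j)‖ ^ 2 - exactSquares q l) ?_ l
  · rw [expect_sub (subGen_run_support_finite δ l), expect_const] at h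
    simp only [subGen, expect_pure, SubGenState.empty, exactSquares] at h
    simp only [NNReal.coe_zero, zero_div, zero_mul, List.map_nil, List.sum_nil, sub_zero] at h
    exact sub_nonpos.1 h
  · intro l a S _
    rw [expect_subGen_step δ S a fun S => (S.mass : ℝ) / s *
      ∑ j, ‖pairPayload q (S.pairs j)‖ ^ 2 - exactSquares q (l ++ [a])]
    simp only [expect_const]
    rw [expect_sub (updatePairs_support_finite _ _ _ _), expect_const, expect_updatePairs]
    simp only [pairPayload_ite, NNReal.coe_add]
    rw [expect_reservoir_sq hs]
    have := normSq_mul_pairPayload_le q a.key a.value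
    simp only [exactSquares, List.map_append, List.sum_append, List.map_cons, List.map_nil,
      List.sum_cons, List.sum_nil]
    linarith

/-- The mean square error of the numerator of SubGen. -/
theorem expect_numerator_error_le {d t s : ℕ} (hs : 0 < s) (δ : ℝ) (q : Vec d)
    (l : List (Token d)) :
    expect ((subGen d t s δ).run l) (fun x => ‖x.1.numerator q - exactNumerator q l‖ ^ 2) ≤
      2 / s * (exactMass l * exactSquares q l) := by
  have hfin := subGen_run_support_finite (t := t) (s := s) δ l
  have h := StreamAlg.expect_run_le (subGen d t s δ) (subGen_init_support_finite δ)
    (subGen_step_support_finite δ) (P := fun _ _ => True) (fun _ _ => trivial)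
    (fun _ _ _ _ _ _ => trivial)
    (fun l (S : SubGenState d t s) =>
      ‖((S.mass : ℝ) / s) • ∑ j, pairPayload q (S.pairs j) - exactNumerator q l‖ ^ 2 -
        2 / s * ((S.mass : ℝ) ^ 2 / s * ∑ j, ‖pairPayload q (S.pairs j)‖ ^ 2)) ?_ l
  · rw [expect_sub hfin] at h
    have h2 : expect ((subGen d t s δ).run l) (fun x =>
        2 / (s : ℝ) * ((x.1.mass : ℝ) ^ 2 / s * ∑ j, ‖pairPayload q (x.1.pairs j)‖ ^ 2)) =
        2 / s * exactMass l * expect ((subGen d t s δ).run l)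
          (fun x => (x.1.mass : ℝ) / s * ∑ j, ‖pairPayload q (x.1.pairs j)‖ ^ 2) := by
      rw [← expect_const_mul]
      refine expect_congr fun x hx => ?_
      rw [subGen_mass_eq δ l x hx]; ring
    have h3 := mul_le_mul_of_nonneg_left (expect_pairs_sq_le (t := t) hs δ q l)
      (by positivity : 0 ≤ 2 / (s : ℝ) * exactMass l)
    simp only [SubGenState.numerator_eq]
    rw [h2] at h
    simp only [subGen, expect_pure, SubGenState.empty, exactNumerator] at h h3 ⊢
    simp only [NNReal.coe_zero, zero_div, zero_smul, List.map_nil, List.sum_nil, sub_zero,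
      norm_zero, zero_mul, mul_zero, ne_eq, OfNat.ofNat_ne_zero, not_false_eq_true, zero_pow] at h
    linarith
  · intro l a S _
    rw [expect_subGen_step δ S a fun S =>
      ‖((S.mass : ℝ) / s) • ∑ j, pairPayload q (S.pairs j) - exactNumerator q (l ++ [a])‖ ^ 2 -
        2 / s * ((S.mass : ℝ) ^ 2 / s * ∑ j, ‖pairPayload q (S.pairs j)‖ ^ 2)]
    simp only [expect_const]
    rw [expect_updatePairs]
    simp only [pairPayload_ite, NNReal.coe_add]
    have e : exactNumerator q (l ++ [a]) = exactNumerator q l +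
        ((‖a.value‖₊ ^ 2 : ℝ≥0) : ℝ) • pairPayload q (a.key, a.value) := by
      rw [normSq_smul_pairPayload]; simp [exactNumerator]
    rw [e]
    exact expect_reservoir_le hs _ _ _ _ _ _

/-! ### Accuracy of the normalizer -/

/-- The estimate of `∑ exp ⟨q, k⟩` over the keys of one cluster. -/
def Cluster.estimate {d t : ℕ} (q : Vec d) (c : Cluster d t) : ℝ :=
  (c.count : ℝ) / t * ∑ j, keyWeight q (c.samples j)

/-- The potential of one cluster, an estimate of `m ∑ exp ⟨q, k⟩ ^ 2` over its `m` keys. -/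
def Cluster.potential {d t : ℕ} (q : Vec d) (c : Cluster d t) : ℝ :=
  (c.count : ℝ) ^ 2 / t * ∑ j, keyWeight q (c.samples j) ^ 2

theorem sum_map_set {α : Type*} (D : List α) (i : Fin D.length) (c : α) (g : α → ℝ) :
    ((D.set i c).map g).sum = (D.map g).sum - g (D.get i) + g c := by
  rw [List.map_set, List.sum_set']
  simp
  ring

theorem SubGenState.normalizer_eq {d t s : ℕ} (S : SubGenState d t s) (q : Vec d) :
    S.normalizer q = (S.clusters.map (Cluster.estimate q)).sum := rfl

theorem expect_updateClusters_le {d t : ℕ} (ht : 0 < t) (δ W : ℝ) (q k : Vec d)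
    (D : List (Cluster d t)) :
    expect (updateClusters δ D k) (fun D => ((D.map (Cluster.estimate q)).sum -
        (W + keyWeight q k)) ^ 2 - 2 / t * (D.map (Cluster.potential q)).sum) ≤
      ((D.map (Cluster.estimate q)).sum - W) ^ 2 - 2 / t * (D.map (Cluster.potential q)).sum := by
  have ht' : (t : ℝ) ≠ 0 := by positivity
  rcases updateClusters_cases δ D k with ⟨-, h⟩ | ⟨i, -, h⟩
  · rw [h, expect_pure]
    simp only [List.map_append, List.sum_append, List.map_cons, List.map_nil, List.sum_cons,
      List.sum_nil, Cluster.estimate, Cluster.potential, Finset.sum_const, Finset.card_univ,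
      Fintype.card_fin, nsmul_eq_mul, Nat.cast_one, one_pow, one_div, add_zero,
      inv_mul_cancel_left₀ ht']
    have h1 : 0 ≤ 2 / (t : ℝ) * keyWeight q k ^ 2 := by positivity
    rw [mul_add]
    set A := (D.map (Cluster.estimate q)).sum
    have h2 : A + keyWeight q k - (W + keyWeight q k) = A - W := by ring
    rw [h2]
    linarith
  · rw [h, expect_map (Cluster.add_support_finite _ _), Cluster.add,
      expect_map (coinFlips_support_finite _ _ _)]
    simp only [sum_map_set]
    set c := D.get i
    set A := (D.map (Cluster.estimate q)).sum
    set B := (D.map (Cluster.potential q)).sum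
    have key := expect_reservoir_le ht (c.count : ℝ≥0) 1
      (div_le_one_of_le₀ (by simp) (by simp)) (keyWeight q k) (W - (A - c.estimate q))
      (fun j => keyWeight q (c.samples j))
    have hR : ‖(((c.count : ℝ≥0) : ℝ) / t) • ∑ j, keyWeight q (c.samples j) -
        (W - (A - c.estimate q))‖ ^ 2 - 2 / t * ((((c.count : ℝ≥0) : ℝ)) ^ 2 / t *
          ∑ j, ‖keyWeight q (c.samples j)‖ ^ 2) =
        (A - W) ^ 2 - 2 / t * c.potential q := by
      rw [Real.norm_eq_abs, sq_abs]
      simp only [Real.norm_eq_abs, sq_abs, smul_eq_mul, NNReal.coe_natCast]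
      rw [← Cluster.estimate, ← Cluster.potential]
      ring
    rw [hR] at key
    have hL : ∀ b : Fin t → Bool,
        (A - c.estimate q + Cluster.estimate q ⟨c.center, c.count + 1,
          fun j => if b j then k else c.samples j⟩ - (W + keyWeight q k)) ^ 2 -
        2 / (t : ℝ) * (B - c.potential q + Cluster.potential q ⟨c.center, c.count + 1,
          fun j => if b j then k else c.samples j⟩) =
        (‖((((c.count : ℝ≥0) : ℝ) + (1 : ℝ≥0)) / t) • (∑ j, if b j then keyWeight q k
            else keyWeight q (c.samples j)) -
          (W - (A - c.estimate q) + ((1 : ℝ≥0) : ℝ) • keyWeight q k)‖ ^ 2 -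
          2 / t * (((((c.count : ℝ≥0) : ℝ)) + (1 : ℝ≥0)) ^ 2 / t *
          ∑ j, ‖if b j then keyWeight q k else keyWeight q (c.samples j)‖ ^ 2)) -
        2 / t * (B - c.potential q) := by
      intro b
      have hi : ∀ j, keyWeight q (if b j then k else c.samples j) =
          if b j then keyWeight q k else keyWeight q (c.samples j) := fun j => by
        split_ifs <;> rfl
      simp only [Real.norm_eq_abs, sq_abs, smul_eq_mul, NNReal.coe_natCast, NNReal.coe_one]
      simp only [Cluster.estimate, Cluster.potential, hi]
      push_cast
      ring
    simp only [hL]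
    rw [expect_sub (coinFlips_support_finite _ _ _), expect_const]
    linarith

/-- All samples of all clusters are close to the centers. -/
def SamplesNear {d t : ℕ} (δ : ℝ) (D : List (Cluster d t)) : Prop :=
  ∀ c ∈ D, ∀ j, ‖c.samples j - c.center‖ ≤ δ

theorem subGen_samplesNear {d t s : ℕ} {δ : ℝ} (hδ : 0 ≤ δ) (l : List (Token d)) :
    ∀ x ∈ ((subGen d t s δ).run l).support, SamplesNear δ x.1.clusters := by
  refine StreamAlg.run_invariant _ (P := fun _ (S : SubGenState d t s) => SamplesNear δ S.clusters)
    ?_ ?_ l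
  · intro S hS
    simp only [subGen, PMF.support_pure, Set.mem_singleton_iff] at hS
    simp [hS, SubGenState.empty, SamplesNear]
  · intro l a S hS x hx
    obtain ⟨-, -, -, ⟨-, h⟩ | ⟨i, hi, b, h⟩⟩ := mem_support_subGen_step hx
    · rw [SamplesNear, h]
      intro c hc
      rcases List.mem_append.1 hc with hc | hc
      · exact hS c hc
      · rw [List.mem_singleton.1 hc]
        intro j
        simpa using hδ
    · rw [SamplesNear, h]
      intro c hc
      rcases List.mem_or_eq_of_mem_set hc with hc | rfl
      · exact hS c hc
      · intro j
        by_cases hb : b j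
        · simpa [hb] using hi
        · simpa [hb] using hS _ (List.get_mem _ i) j

/-- Samples of a cluster lie within `2 δ` of each other, so their weights differ by a factor of at
most `exp (2 δ r)`, and the mean of their squares is at most that factor times the square of
their mean. -/
theorem Cluster.potential_le {d t : ℕ} (ht : 0 < t) {δ r : ℝ} {q : Vec d}
    (hq : ‖q‖ ≤ r) {c : Cluster d t} (hc : ∀ j, ‖c.samples j - c.center‖ ≤ δ) :
    c.potential q ≤ Real.exp (2 * δ * r) * c.estimate q ^ 2 := by
  have hfac : ∀ i j, keyWeight q (c.samples i) ≤
      Real.exp (2 * δ * r) * keyWeight q (c.samples j) := by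
    intro i j
    rw [keyWeight, keyWeight, ← Real.exp_add]
    refine Real.exp_le_exp.2 ?_
    have h1 : inner ℝ q (c.samples i) - inner ℝ q (c.samples j) ≤ r * (2 * δ) := by
      rw [← inner_sub_right]
      refine (real_inner_le_norm _ _).trans ?_
      refine mul_le_mul hq ?_ (norm_nonneg _) ((norm_nonneg q).trans hq)
      calc ‖c.samples i - c.samples j‖ =
          ‖(c.samples i - c.center) - (c.samples j - c.center)‖ := by rw [sub_sub_sub_cancel_right]
        _ ≤ _ := norm_sub_le _ _
        _ ≤ 2 * δ := by linarith [hc i, hc j]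
    linarith
  have ht' : (t : ℝ) ≠ 0 := by positivity
  have h2 : (t : ℝ) * ∑ i, keyWeight q (c.samples i) ^ 2 ≤
      Real.exp (2 * δ * r) * (∑ j, keyWeight q (c.samples j)) ^ 2 := by
    have : (t : ℝ) * ∑ i, keyWeight q (c.samples i) ^ 2 =
        ∑ i, ∑ _j : Fin t, keyWeight q (c.samples i) ^ 2 := by
      simp [Finset.mul_sum]
    rw [this, sq (∑ j, keyWeight q (c.samples j)), Finset.sum_mul_sum, Finset.mul_sum]
    refine Finset.sum_le_sum fun i _ => ?_
    rw [Finset.mul_sum]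
    refine Finset.sum_le_sum fun j _ => ?_
    rw [sq, mul_left_comm]
    exact mul_le_mul_of_nonneg_left (hfac i j) (keyWeight_pos _ _).le
  have h3 := mul_le_mul_of_nonneg_left h2 (by positivity : 0 ≤ (c.count : ℝ) ^ 2 / t ^ 2)
  have h4 : c.potential q = (c.count : ℝ) ^ 2 / t ^ 2 *
      ((t : ℝ) * ∑ i, keyWeight q (c.samples i) ^ 2) := by
    rw [Cluster.potential]; field_simp
  rw [h4]
  refine h3.trans (le_of_eq ?_)
  rw [Cluster.estimate]; ring

theorem sum_potential_le {d t : ℕ} (ht : 0 < t) {δ r : ℝ} {q : Vec d} (hq : ‖q‖ ≤ r)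
    {D : List (Cluster d t)} (hD : SamplesNear δ D) :
    (D.map (Cluster.potential q)).sum ≤
      Real.exp (2 * δ * r) * (D.map (Cluster.estimate q)).sum ^ 2 := by
  have hest : ∀ c : Cluster d t, 0 ≤ c.estimate q := fun c =>
    mul_nonneg (by positivity) (Finset.sum_nonneg fun j _ => (keyWeight_pos _ _).le)
  induction D with
  | nil => simp
  | cons c D ih =>
    have h1 := ih fun c hc => hD c (List.mem_cons_of_mem _ hc)
    have h2 := Cluster.potential_le ht hq (hD c List.mem_cons_self)
    have h3 : 0 ≤ (D.map (Cluster.estimate q)).sum :=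
      List.sum_nonneg fun x hx => by
        obtain ⟨c, -, rfl⟩ := List.mem_map.1 hx
        exact hest c
    have h4 : 0 ≤ Real.exp (2 * δ * r) * (2 * (c.estimate q * (D.map (Cluster.estimate q)).sum)) :=
      mul_nonneg (Real.exp_pos _).le (mul_nonneg zero_le_two (mul_nonneg (hest c) h3))
    simp only [List.map_cons, List.sum_cons]
    nlinarith

/-- The mean square error of the normalizer of SubGen, when the number of samples per cluster
exceeds `exp (2 δ r)` by a sufficient factor. -/
theorem expect_normalizer_error_le {d t s : ℕ} (ht : 0 < t) {δ r : ℝ} (hδ : 0 ≤ δ) {q : Vec d}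
    (hq : ‖q‖ ≤ r) (htr : 8 * Real.exp (2 * δ * r) ≤ t) (l : List (Token d)) :
    expect ((subGen d t s δ).run l) (fun x => (x.1.normalizer q - exactNormalizer q l) ^ 2) ≤
      8 * Real.exp (2 * δ * r) / t * exactNormalizer q l ^ 2 := by
  have hfin := subGen_run_support_finite (t := t) (s := s) δ l
  have ht0 : (0 : ℝ) < t := by positivity
  have h := StreamAlg.expect_run_le (subGen d t s δ) (subGen_init_support_finite δ)
    (subGen_step_support_finite δ) (P := fun _ _ => True) (fun _ _ => trivial)
    (fun _ _ _ _ _ _ => trivial)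
    (fun l (S : SubGenState d t s) =>
      ((S.clusters.map (Cluster.estimate q)).sum - exactNormalizer q l) ^ 2 -
        2 / t * (S.clusters.map (Cluster.potential q)).sum) ?_ l
  · set W := exactNormalizer q l with hW
    set X := expect ((subGen d t s δ).run l) (fun x => (x.1.normalizer q - W) ^ 2) with hX
    set Λ := Real.exp (2 * δ * r)
    rw [expect_sub hfin] at h
    have h0 : expect (subGen d t s δ).init (fun S : SubGenState d t s =>
        ((S.clusters.map (Cluster.estimate q)).sum - exactNormalizer q []) ^ 2 -
        2 / t * (S.clusters.map (Cluster.potential q)).sum) = 0 := by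
      simp [subGen, expect_pure, SubGenState.empty, exactNormalizer]
    rw [h0] at h
    have h1 : expect ((subGen d t s δ).run l)
        (fun x => 2 / (t : ℝ) * (x.1.clusters.map (Cluster.potential q)).sum) ≤
        expect ((subGen d t s δ).run l)
          (fun x => 4 * Λ / t * W ^ 2 + 4 * Λ / t * (x.1.normalizer q - W) ^ 2) := by
      refine expect_mono hfin fun x hx => ?_
      have h2 := sum_potential_le ht hq (subGen_samplesNear hδ l x hx)
      rw [← SubGenState.normalizer_eq] at h2
      have h3 : x.1.normalizer q ^ 2 ≤ 2 * (W ^ 2 + (x.1.normalizer q - W) ^ 2) := by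
        nlinarith [sq_nonneg (x.1.normalizer q - 2 * W)]
      have h4 : 2 / (t : ℝ) * (x.1.clusters.map (Cluster.potential q)).sum ≤
          2 / t * (Λ * (2 * (W ^ 2 + (x.1.normalizer q - W) ^ 2))) :=
        mul_le_mul_of_nonneg_left
          (h2.trans (mul_le_mul_of_nonneg_left h3 (Real.exp_pos _).le)) (by positivity)
      refine h4.trans (le_of_eq ?_)
      ring
    rw [expect_add hfin, expect_const,
      expect_const_mul _ (fun x : SubGenState d t s × Vec d => (x.1.normalizer q - W) ^ 2),
      ← hX] at h1
    -- the mean square error occurs on both sides, on the right with a factor of at most `1 / 2`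
    have hXle : X ≤ 4 * Λ / t * W ^ 2 + 4 * Λ / t * X := by
      have : X - _ ≤ 0 := h
      linarith
    have hX0 : 0 ≤ X := expect_nonneg fun _ => sq_nonneg _
    have h5 : 4 * Λ / t ≤ 1 / 2 := by
      rw [div_le_iff₀ ht0]; linarith
    have h6 := mul_le_mul_of_nonneg_right h5 hX0
    have h7 : 8 * Λ / t * W ^ 2 = 2 * (4 * Λ / t * W ^ 2) := by ring
    linarith
  · intro l a S _
    rw [expect_subGen_step δ S a fun S =>
      ((S.clusters.map (Cluster.estimate q)).sum - exactNormalizer q (l ++ [a])) ^ 2 -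
        2 / t * (S.clusters.map (Cluster.potential q)).sum]
    simp only [expect_const]
    have e : exactNormalizer q (l ++ [a]) = exactNormalizer q l + keyWeight q a.key := by
      simp [exactNormalizer]
    rw [e]
    exact expect_updateClusters_le ht δ _ q a.key S.clusters

/-! ### Attention in terms of sums over the stream -/

section Attention

variable {n d : ℕ} (q : Vec d) (x : Fin n → Token d)

theorem exp_keyMatrix_mulVec (i : Fin n) :
    Real.exp ((keyMatrix x *ᵥ q.ofLp) i) = keyWeight q (x i).key := by
  rw [keyWeight, EuclideanSpace.inner_eq_star_dotProduct]
  simp [Matrix.mulVec, keyMatrix, dotProduct]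

theorem exactNormalizer_ofFn :
    exactNormalizer q (List.ofFn x) = ∑ i, keyWeight q (x i).key := by
  simp [exactNormalizer, List.map_ofFn, List.sum_ofFn]

theorem exactSquares_ofFn :
    exactSquares q (List.ofFn x) = ∑ i, keyWeight q (x i).key ^ 2 := by
  simp [exactSquares, List.map_ofFn, List.sum_ofFn]

theorem exactNumerator_ofFn :
    exactNumerator q (List.ofFn x) = ∑ i, keyWeight q (x i).key • (x i).value := by
  simp [exactNumerator, List.map_ofFn, List.sum_ofFn]

theorem exactMass_ofFn : (exactMass (List.ofFn x) : ℝ) = ∑ i, ‖(x i).value‖ ^ 2 := by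
  simp [exactMass, List.map_ofFn, List.sum_ofFn]

theorem softmax_keyMatrix (i : Fin n) : softmax (keyMatrix x *ᵥ q.ofLp) i =
    keyWeight q (x i).key / exactNormalizer q (List.ofFn x) := by
  simp only [softmax, exp_keyMatrix_mulVec, exactNormalizer_ofFn]

theorem attn_eq : attn q (keyMatrix x) (valueMatrix x) =
    (exactNormalizer q (List.ofFn x))⁻¹ • exactNumerator q (List.ofFn x) := by
  ext j
  rw [exactNumerator_ofFn]
  simp only [attn, Matrix.vecMul, dotProduct, softmax_keyMatrix, valueMatrix, Matrix.of_apply,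
    PiLp.smul_apply, WithLp.ofLp_sum, Finset.sum_apply, smul_eq_mul, Finset.mul_sum,
    PiLp.toLp_apply, WithLp.ofLp_smul, Pi.smul_apply]
  exact Finset.sum_congr rfl fun i _ => by ring

theorem exactNormalizer_nonneg : 0 ≤ exactNormalizer q (List.ofFn x) := by
  rw [exactNormalizer_ofFn]
  exact Finset.sum_nonneg fun i _ => (keyWeight_pos _ _).le

theorem softmaxNorm_eq : softmaxNorm q (keyMatrix x) =
    √(exactSquares q (List.ofFn x)) / exactNormalizer q (List.ofFn x) := by
  rw [softmaxNorm, EuclideanSpace.norm_eq]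
  simp only [softmax_keyMatrix, Real.norm_eq_abs, sq_abs, div_pow]
  rw [← Finset.sum_div, exactSquares_ofFn, Real.sqrt_div (Finset.sum_nonneg fun _ _ => sq_nonneg _),
    Real.sqrt_sq (exactNormalizer_nonneg q x)]

open scoped Matrix.Norms.L2Operator in
theorem norm_exactNumerator_le : ‖exactNumerator q (List.ofFn x)‖ ≤
    matrixSpectralNorm (valueMatrix x) * √(exactSquares q (List.ofFn x)) := by
  have h := Matrix.l2_opNorm_mulVec (valueMatrix x)ᴴ
    (WithLp.toLp 2 fun i => keyWeight q (x i).key)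
  rw [Matrix.l2_opNorm_conjTranspose] at h
  have h1 : (WithLp.toLp 2 ((valueMatrix x)ᴴ *ᵥ
      (WithLp.toLp 2 fun i => keyWeight q (x i).key : EuclideanSpace ℝ (Fin n)).ofLp) : Vec d) =
      exactNumerator q (List.ofFn x) := by
    ext j
    rw [exactNumerator_ofFn]
    simp [Matrix.mulVec, dotProduct, valueMatrix, mul_comm]
  have h2 : ‖(WithLp.toLp 2 fun i => keyWeight q (x i).key : EuclideanSpace ℝ (Fin n))‖ =
      √(exactSquares q (List.ofFn x)) := by
    rw [EuclideanSpace.norm_eq, exactSquares_ofFn]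
    simp
  rw [h2] at h
  rw [← h1]
  exact h

open scoped Matrix.Norms.L2Operator in
/-- The squared Frobenius norm of the value matrix is at most `d` times its squared spectral
norm. -/
theorem exactMass_le :
    (exactMass (List.ofFn x) : ℝ) ≤ d * matrixSpectralNorm (valueMatrix x) ^ 2 := by
  rw [exactMass_ofFn]
  have h1 : ∀ i, ‖(x i).value‖ ^ 2 = ∑ j, (x i).value j ^ 2 := fun i => by
    rw [EuclideanSpace.norm_sq_eq]; simp
  simp only [h1]
  rw [Finset.sum_comm]
  have h2 : ∀ j : Fin d, ∑ i, (x i).value j ^ 2 ≤ matrixSpectralNorm (valueMatrix x) ^ 2 := by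
    intro j
    have h := Matrix.l2_opNorm_mulVec (valueMatrix x) (EuclideanSpace.single j (1 : ℝ))
    rw [PiLp.norm_single, norm_one, mul_one] at h
    have h3 := pow_le_pow_left₀ (norm_nonneg _) h 2
    refine le_trans (le_of_eq ?_) h3
    rw [EuclideanSpace.norm_sq_eq]
    simp [valueMatrix]
  calc ∑ j, ∑ i, (x i).value j ^ 2 ≤ ∑ _j : Fin d, matrixSpectralNorm (valueMatrix x) ^ 2 :=
      Finset.sum_le_sum fun j _ => h2 j
    _ = _ := by simp

end Attention

/-! ### Accuracy of SubGen -/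

theorem subGen_output_eq {d t s i : ℕ} (δ : ℝ) (hi : 0 < i) (x : Fin i → Token d) :
    ∀ y ∈ ((subGen d t s δ).run (List.ofFn x)).support, y.2 = y.1.answer (lastQuery hi x) := by
  obtain ⟨k, rfl⟩ := Nat.exists_eq_add_one_of_ne_zero hi.ne'
  intro y hy
  rw [List.ofFn_succ', List.concat_eq_append, StreamAlg.run_append_singleton,
    PMF.mem_support_bind_iff] at hy
  obtain ⟨z, -, hz⟩ := hy
  exact (mem_support_subGen_step hz).1

/-- If `z` and `τ` approximate `Z` and `W`, then `z / τ` approximates `Z / W`. -/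
theorem norm_inv_smul_sub_le {E : Type*} [NormedAddCommGroup E] [NormedSpace ℝ E] {z Z : E}
    {τ W N ε : ℝ} (hW : 0 < W) (hε : 0 < ε) (hε1 : ε < 1) (hZ : ‖Z‖ ≤ N)
    (hz : ‖z - Z‖ ≤ ε / 4 * N) (hτ : |τ - W| ≤ ε / 4 * W) :
    ‖τ⁻¹ • z - W⁻¹ • Z‖ ≤ ε * (N / W) := by
  have hN : 0 ≤ N := (norm_nonneg _).trans hZ
  have hτW : 3 / 4 * W ≤ τ := by
    have := (abs_le.1 hτ).1
    nlinarith
  have hτ0 : 0 < τ := by nlinarith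
  have e : τ⁻¹ • z - W⁻¹ • Z = τ⁻¹ • ((z - Z) - ((τ - W) / W) • Z) := by
    rw [smul_sub, smul_sub, smul_smul, sub_sub, ← add_smul]
    congr 2
    field_simp
    ring
  have h1 : ‖((τ - W) / W) • Z‖ ≤ ε / 4 * N := by
    rw [norm_smul, Real.norm_eq_abs, abs_div, abs_of_pos hW]
    refine mul_le_mul ?_ hZ (norm_nonneg _) (by positivity)
    rwa [div_le_iff₀ hW]
  rw [e, norm_smul, norm_inv, Real.norm_eq_abs, abs_of_pos hτ0]
  have h2 : ‖(z - Z) - ((τ - W) / W) • Z‖ ≤ ε / 2 * N :=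
    (norm_sub_le _ _).trans (by linarith)
  have h3 : τ⁻¹ ≤ 4 / 3 * W⁻¹ := by
    rw [← div_eq_mul_inv, inv_le_comm₀ hτ0 (by positivity), inv_div]
    refine le_trans (le_of_eq ?_) hτW
    field_simp
  calc τ⁻¹ * ‖(z - Z) - ((τ - W) / W) • Z‖ ≤ 4 / 3 * W⁻¹ * (ε / 2 * N) :=
        mul_le_mul h3 h2 (norm_nonneg _) (by positivity)
    _ = 2 / 3 * (ε * (N / W)) := by rw [div_eq_mul_inv]; ring
    _ ≤ ε * (N / W) := by
      have : 0 ≤ ε * (N / W) := by positivity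
      linarith

/-- Chebyshev's inequality for the numerator and the normalizer. -/
theorem subGen_accuracy {d t s : ℕ} {δ r ε : ℝ} (hδ : 0 ≤ δ) (hε : 0 < ε) (hε1 : ε < 1)
    (hs : 0 < s) (ht : 0 < t) (htε : 25600 * (ε ^ 2)⁻¹ * Real.exp (2 * δ * r) ≤ t)
    (hsε : 25600 * (ε ^ 2)⁻¹ * d ≤ s) {i : ℕ} (hi : 0 < i) (x : Fin i → Token d)
    (hq : ‖lastQuery hi x‖ ≤ r) :
    99 / 100 ≤ (subGen d t s δ).outputProb x (IsSpectralApprox ε hi x) := by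
  set q := lastQuery hi x with hqdef
  set l := List.ofFn x with hl
  set p := (subGen d t s δ).run l
  have hfin : p.support.Finite := subGen_run_support_finite δ l
  set Λ := Real.exp (2 * δ * r)
  have hΛ : 0 < Λ := Real.exp_pos _
  set W := exactNormalizer q l with hWdef
  set F := exactSquares q l with hFdef
  set N := matrixSpectralNorm (valueMatrix x) * √F with hN
  have hs0 : (0 : ℝ) < s := by positivity
  have ht0 : (0 : ℝ) < t := by positivity
  have hW : 0 < W := by
    have : Nonempty (Fin i) := ⟨⟨0, hi⟩⟩
    rw [hWdef, hl, exactNormalizer_ofFn]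
    exact Finset.sum_pos (fun j _ => keyWeight_pos _ _) Finset.univ_nonempty
  have hF : 0 ≤ F := by
    rw [hFdef, hl, exactSquares_ofFn]
    exact Finset.sum_nonneg fun j _ => sq_nonneg _
  have hZ : ‖exactNumerator q l‖ ≤ N := norm_exactNumerator_le q x
  have hN0 : 0 ≤ N := (norm_nonneg _).trans hZ
  have hN2 : N ^ 2 = matrixSpectralNorm (valueMatrix x) ^ 2 * F := by
    rw [hN, mul_pow, Real.sq_sqrt hF]
  have hε2 : 0 < ε ^ 2 := by positivity
  have htε' : 25600 * Λ ≤ ε ^ 2 * t := by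
    have := mul_le_mul_of_nonneg_left htε hε2.le
    calc 25600 * Λ = ε ^ 2 * (25600 * (ε ^ 2)⁻¹ * Λ) := by field_simp
      _ ≤ _ := this
  have hsε' : 25600 * d ≤ ε ^ 2 * s := by
    have := mul_le_mul_of_nonneg_left hsε hε2.le
    calc (25600 * d : ℝ) = ε ^ 2 * (25600 * (ε ^ 2)⁻¹ * d) := by field_simp
      _ ≤ _ := this
  have hε21 : ε ^ 2 ≤ 1 := by nlinarith
  have hbad1 : p.toOuterMeasure {y | (ε / 4 * N) ^ 2 < ‖y.1.numerator q - exactNumerator q l‖ ^ 2} ≤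
      ENNReal.ofReal (1 / 200) := by
    refine measure_gt_le_of_expect_le hfin (fun _ => sq_nonneg _) (sq_nonneg _) (by norm_num)
      ((expect_numerator_error_le hs δ q l).trans ?_)
    have h1 : (exactMass l : ℝ) * F ≤ d * N ^ 2 := by
      rw [hN2, ← mul_assoc]
      exact mul_le_mul_of_nonneg_right (exactMass_le x) hF
    rw [← hFdef, div_mul_eq_mul_div, div_le_iff₀ hs0]
    have h2 := mul_le_mul_of_nonneg_right hsε' (sq_nonneg N)
    nlinarith
  have hbad2 : p.toOuterMeasure {y | (ε / 4 * W) ^ 2 < (y.1.normalizer q - W) ^ 2} ≤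
      ENNReal.ofReal (1 / 200) := by
    refine measure_gt_le_of_expect_le hfin (fun _ => sq_nonneg _) (sq_nonneg _) (by norm_num)
      ((expect_normalizer_error_le ht hδ hq (by nlinarith) l).trans ?_)
    rw [← hWdef, div_mul_eq_mul_div, div_le_iff₀ ht0]
    have h2 := mul_le_mul_of_nonneg_right htε' (sq_nonneg W)
    nlinarith
  have hcover : p.support ⊆ {y | IsSpectralApprox ε hi x y.2} ∪
      ({y | (ε / 4 * N) ^ 2 < ‖y.1.numerator q - exactNumerator q l‖ ^ 2} ∪
        {y | (ε / 4 * W) ^ 2 < (y.1.normalizer q - W) ^ 2}) := by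
    intro y hy
    by_contra hcon
    simp only [Set.mem_union, Set.mem_ofPred_eq, not_or, not_lt] at hcon
    obtain ⟨h0, h1, h2⟩ := hcon
    apply h0
    have h1' := (sq_le_sq₀ (norm_nonneg _) (by positivity)).1 h1
    have h2' := abs_le_of_sq_le_sq h2 (by positivity)
    have h3 := norm_inv_smul_sub_le hW hε hε1 hZ h1' h2'
    rw [IsSpectralApprox, subGen_output_eq δ hi x y hy, lastAttn, attn_eq, softmaxNorm_eq,
      SubGenState.answer]
    refine h3.trans (le_of_eq ?_)
    rw [hN]; ring
  have hone : p.toOuterMeasure p.support = 1 := (PMF.toOuterMeasure_apply_eq_one_iff _ _).2 le_rfl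
  have hle : (1 : ℝ≥0∞) ≤ p.toOuterMeasure {y | IsSpectralApprox ε hi x y.2} +
      ENNReal.ofReal (1 / 100) := by
    rw [← hone]
    refine (MeasureTheory.measure_mono hcover).trans ((MeasureTheory.measure_union_le _ _).trans ?_)
    refine add_le_add le_rfl ((MeasureTheory.measure_union_le _ _).trans
      ((add_le_add hbad1 hbad2).trans (le_of_eq ?_)))
    rw [← ENNReal.ofReal_add (by norm_num) (by norm_num)]
    norm_num
  have h99 : (99 / 100 : ℝ≥0∞) = 1 - ENNReal.ofReal (1 / 100) := by
    rw [← ENNReal.ofReal_one, ← ENNReal.ofReal_sub _ (by norm_num)]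
    rw [show (1 - 1 / 100 : ℝ) = 99 / 100 by norm_num, ENNReal.ofReal_div_of_pos (by norm_num)]
    norm_num
  rw [h99]
  exact tsub_le_iff_right.2 hle

theorem one_le_log_of_three_le {n : ℕ} (hn : 3 ≤ n) : 1 ≤ Real.log n := by
  rw [Real.le_log_iff_exp_le (by positivity)]
  have : (3 : ℝ) ≤ n := by exact_mod_cast hn
  linarith [Real.exp_one_lt_three]

theorem tunedSubGen_accuracy {a : ℝ} (ha : 25600 ≤ a) {n d : ℕ} (hn : 3 ≤ n) (hd : 0 < d)
    {δ r ε : ℝ} (hδ : 0 ≤ δ) (hε : 0 < ε) (hε1 : ε < 1) {i : ℕ} (hi : 0 < i)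
    (x : Fin i → Token d) (hq : ∀ l, ‖(x l).query‖ ≤ r) :
    99 / 100 ≤ (tunedSubGen a ε δ r n d).outputProb x (IsSpectralApprox ε hi x) := by
  have hlog := one_le_log_of_three_le hn
  have hd' : (0 : ℝ) < d := by exact_mod_cast hd
  have ha0 : 0 < a := by linarith
  have ht1 : 25600 * (ε ^ 2)⁻¹ * Real.exp (2 * δ * r) ≤ clusterSamples a ε δ r n := by
    refine le_trans ?_ (Nat.le_ceil _)
    calc 25600 * (ε ^ 2)⁻¹ * Real.exp (2 * δ * r) ≤ a * (ε ^ 2)⁻¹ * Real.exp (2 * δ * r) := by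
          gcongr
      _ ≤ _ := le_mul_of_one_le_right (by positivity) hlog
  have hs1 : 25600 * (ε ^ 2)⁻¹ * d ≤ pairSamples a ε d := by
    refine le_trans ?_ (Nat.le_ceil _)
    gcongr
  refine subGen_accuracy hδ hε hε1 ?_ ?_ ht1 hs1 hi x (hq _)
  · exact Nat.ceil_pos.2 (by positivity)
  · have : 0 < Real.log n := by linarith
    exact Nat.ceil_pos.2 (by positivity)

/-! ### Packing in the unit ball -/

theorem sum_sum_norm_sub_sq {E ι : Type*} [NormedAddCommGroup E] [InnerProductSpace ℝ E]
    (T : Finset ι) (z : ι → E) :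
    ∑ i ∈ T, ∑ j ∈ T, ‖z i - z j‖ ^ 2 =
      2 * (T.card * ∑ i ∈ T, ‖z i‖ ^ 2) - 2 * ‖∑ i ∈ T, z i‖ ^ 2 := by
  have h : ‖∑ i ∈ T, z i‖ ^ 2 = ∑ i ∈ T, ∑ j ∈ T, inner ℝ (z i) (z j) := by
    rw [← real_inner_self_eq_norm_sq, sum_inner]
    exact Finset.sum_congr rfl fun i _ => inner_sum _ _ _
  rw [h]
  simp only [norm_sub_sq_real, Finset.sum_add_distrib, Finset.sum_sub_distrib, Finset.sum_const,
    nsmul_eq_mul, ← Finset.mul_sum]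
  ring

/-- Few points that are mutually more than `e / 3` apart lie in a ball of radius `7 / 12`. -/
theorem card_le_ten_of_separated {E ι : Type*} [NormedAddCommGroup E] [InnerProductSpace ℝ E]
    (T : Finset ι) (z : ι → E) (hz : ∀ i ∈ T, ‖z i‖ ≤ 7 / 12)
    (hsep : ∀ i ∈ T, ∀ j ∈ T, i ≠ j → Real.exp 1 / 3 < ‖z i - z j‖) : T.card ≤ 10 := by
  classical
  by_contra! hcard
  have hm : (11 : ℝ) ≤ T.card := by exact_mod_cast hcard
  set m : ℝ := (T.card : ℝ) with hm'
  have h1 := sum_sum_norm_sub_sq T z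
  have h2 : ∑ i ∈ T, ‖z i‖ ^ 2 ≤ m * (7 / 12) ^ 2 := by
    calc ∑ i ∈ T, ‖z i‖ ^ 2 ≤ ∑ _i ∈ T, (7 / 12 : ℝ) ^ 2 :=
        Finset.sum_le_sum fun i hi => pow_le_pow_left₀ (norm_nonneg _) (hz i hi) 2
      _ = _ := by rw [Finset.sum_const, nsmul_eq_mul]
  have h3 : m * (m - 1) * (9 / 10) ^ 2 ≤ ∑ i ∈ T, ∑ j ∈ T, ‖z i - z j‖ ^ 2 := by
    have hrow : ∀ i ∈ T, (m - 1) * (9 / 10) ^ 2 ≤ ∑ j ∈ T, ‖z i - z j‖ ^ 2 := by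
      intro i hi
      have hc : ((T.erase i).card : ℝ) = m - 1 := by
        rw [Finset.card_erase_of_mem hi, Nat.cast_sub (by omega)]; simp [m]
      rw [← Finset.add_sum_erase T _ hi, ← hc, ← nsmul_eq_mul, ← Finset.sum_const]
      have : ∑ j ∈ T.erase i, (9 / 10 : ℝ) ^ 2 ≤ ∑ j ∈ T.erase i, ‖z i - z j‖ ^ 2 := by
        refine Finset.sum_le_sum fun j hj => pow_le_pow_left₀ (by norm_num) ?_ 2
        have := hsep i hi j (Finset.mem_of_mem_erase hj) (Finset.ne_of_mem_erase hj).symm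
        linarith [Real.exp_one_gt_d9]
      have h0 : 0 ≤ ‖z i - z i‖ ^ 2 := sq_nonneg _
      linarith
    calc m * (m - 1) * (9 / 10) ^ 2 = ∑ _i ∈ T, (m - 1) * (9 / 10 : ℝ) ^ 2 := by
          rw [Finset.sum_const, nsmul_eq_mul]; ring
      _ ≤ _ := Finset.sum_le_sum hrow
  have h4 : 0 ≤ ‖∑ i ∈ T, z i‖ ^ 2 := sq_nonneg _
  have h5 := mul_le_mul_of_nonneg_left h2 (by linarith : 0 ≤ m)
  nlinarith

/-- At most `10 e ^ d` points of the unit ball are mutually more than `e / 3` apart: by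
`card_le_ten_of_separated` the balls of radius `ρ = 7 / 12` around them cover no point more than
ten times, and `(1 + ρ) / ρ ≤ e`. -/
theorem card_le_of_separated {d N : ℕ} (x : Fin N → Vec d) (hx : ∀ i, ‖x i‖ ≤ 1)
    (hsep : ∀ i j, i ≠ j → Real.exp 1 / 3 < ‖x i - x j‖) : (N : ℝ) ≤ 10 * Real.exp d := by
  classical
  open MeasureTheory in
  have hpt : ∀ y : Vec d, ∑ i, (Metric.ball (x i) (7 / 12)).indicator (1 : Vec d → ℝ≥0∞) y ≤
      (Metric.ball (0 : Vec d) (19 / 12)).indicator (fun _ => 10) y := by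
    intro y
    have hcount : ∑ i, (Metric.ball (x i) (7 / 12)).indicator (1 : Vec d → ℝ≥0∞) y =
        ((Finset.univ.filter fun i => y ∈ Metric.ball (x i) (7 / 12)).card : ℝ≥0∞) := by
      simp [Set.indicator_apply]
    rw [hcount]
    by_cases hy : y ∈ Metric.ball (0 : Vec d) (19 / 12)
    · rw [Set.indicator_of_mem hy]
      have := card_le_ten_of_separated (Finset.univ.filter fun i => y ∈ Metric.ball (x i) (7 / 12))
        (fun i => x i - y) (fun i hi => by
          have := (Finset.mem_filter.1 hi).2
          rw [Metric.mem_ball, dist_comm, dist_eq_norm] at this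
          exact this.le) (fun i _ j _ hij => by
          rw [sub_sub_sub_cancel_right]; exact hsep i j hij)
      exact_mod_cast this
    · rw [Set.indicator_of_notMem hy, nonpos_iff_eq_zero, Nat.cast_eq_zero, Finset.card_eq_zero,
        Finset.filter_eq_empty_iff]
      intro i _ hi
      apply hy
      rw [Metric.mem_ball, dist_eq_norm] at hi
      rw [mem_ball_zero_iff]
      calc ‖y‖ = ‖(y - x i) + x i‖ := by rw [sub_add_cancel]
        _ ≤ ‖y - x i‖ + ‖x i‖ := norm_add_le _ _
        _ < 19 / 12 := by linarith [hx i]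
  have hint := MeasureTheory.lintegral_mono (μ := MeasureTheory.volume) hpt
  rw [MeasureTheory.lintegral_finsetSum _ fun i _ =>
    (measurable_one.indicator measurableSet_ball)] at hint
  simp only [MeasureTheory.lintegral_indicator_one measurableSet_ball,
    MeasureTheory.lintegral_indicator_const measurableSet_ball] at hint
  have hball : ∀ (c : Vec d) {ρ : ℝ}, 0 < ρ → MeasureTheory.volume (Metric.ball c ρ) =
      ENNReal.ofReal (ρ ^ d) * MeasureTheory.volume (Metric.ball (0 : Vec d) 1) := by
    intro c ρ hρ
    rw [MeasureTheory.Measure.addHaar_ball_of_pos _ _ hρ, finrank_euclideanSpace_fin]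
  simp only [hball _ (by norm_num : (0 : ℝ) < 7 / 12),
    hball _ (by norm_num : (0 : ℝ) < 19 / 12)] at hint
  have hv0 : MeasureTheory.volume (Metric.ball (0 : Vec d) 1) ≠ 0 :=
    (Metric.measure_ball_pos _ _ one_pos).ne'
  have hvt : MeasureTheory.volume (Metric.ball (0 : Vec d) 1) ≠ ⊤ :=
    MeasureTheory.measure_ball_lt_top.ne
  rw [Finset.sum_const, Finset.card_univ, Fintype.card_fin, nsmul_eq_mul, ← mul_assoc, ← mul_assoc,
    ENNReal.mul_le_mul_iff_left hv0 hvt] at hint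
  have h1 : (N : ℝ) * (7 / 12) ^ d ≤ 10 * (19 / 12) ^ d := by
    have h2 : ((N : ℝ≥0∞) * ENNReal.ofReal ((7 / 12) ^ d)) =
        ENNReal.ofReal (N * (7 / 12) ^ d) := by
      rw [ENNReal.ofReal_mul (by positivity), ENNReal.ofReal_natCast]
    have h3 : ((10 : ℝ≥0∞) * ENNReal.ofReal ((19 / 12) ^ d)) =
        ENNReal.ofReal (10 * (19 / 12) ^ d) := by
      rw [ENNReal.ofReal_mul (by positivity)]
      norm_num
    rw [h2, h3] at hint
    exact (ENNReal.ofReal_le_ofReal_iff (by positivity)).1 hint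
  have h4 : (19 / 12 : ℝ) ^ d ≤ Real.exp d * (7 / 12) ^ d := by
    rw [← Real.exp_one_pow, ← mul_pow]
    refine pow_le_pow_left₀ (by norm_num) ?_ d
    linarith [Real.exp_one_gt_d9]
  have h5 : (0 : ℝ) < (7 / 12) ^ d := by positivity
  refine le_of_mul_le_mul_right ?_ h5
  linarith

theorem subGen_centers {d t s : ℕ} {δ : ℝ} (l : List (Token d)) :
    ∀ x ∈ ((subGen d t s δ).run l).support, (∀ a ∈ l, ‖a.key‖ ≤ 1) →
      (∀ k ∈ x.1.clusters.map Cluster.center, ‖k‖ ≤ 1) ∧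
      (x.1.clusters.map Cluster.center).Pairwise fun k k' => δ < ‖k - k'‖ := by
  refine StreamAlg.run_invariant _ (P := fun l (S : SubGenState d t s) =>
    (∀ a ∈ l, ‖a.key‖ ≤ 1) → (∀ k ∈ S.clusters.map Cluster.center, ‖k‖ ≤ 1) ∧
      (S.clusters.map Cluster.center).Pairwise fun k k' => δ < ‖k - k'‖) ?_ ?_ l
  · intro S hS
    simp only [subGen, PMF.support_pure, Set.mem_singleton_iff] at hS
    simp [hS, SubGenState.empty]
  · intro l a S hS x hx hl
    obtain ⟨h1, h2⟩ := hS fun a ha => hl a (List.mem_append_left _ ha)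
    obtain ⟨-, -, -, ⟨hfar, h⟩ | ⟨i, hi, b, h⟩⟩ := mem_support_subGen_step hx
    · rw [h, List.map_append, List.map_singleton]
      constructor
      · intro k hk
        rcases List.mem_append.1 hk with hk | hk
        · exact h1 k hk
        · rw [List.mem_singleton.1 hk]
          exact hl a (by simp)
      · refine List.pairwise_append.2 ⟨h2, List.pairwise_singleton _ _, ?_⟩
        intro k hk k' hk'
        obtain ⟨c, hc, rfl⟩ := List.mem_map.1 hk
        rw [List.mem_singleton.1 hk', norm_sub_rev]
        exact hfar c hc
    · have e : x.1.clusters.map Cluster.center = S.clusters.map Cluster.center := by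
        rw [h, List.map_set]
        refine List.ext_getElem (by simp) fun j h1 h2 => ?_
        rw [List.getElem_set]
        split_ifs with hij
        · subst hij; simp
        · rfl
      rw [e]
      exact ⟨h1, h2⟩

theorem subGen_clusters_length_le {d t s : ℕ} {l : List (Token d)}
    {x : SubGenState d t s × Vec d}
    (hx : x ∈ ((subGen d t s (Real.exp 1 / 3)).run l).support) (hl : ∀ a ∈ l, ‖a.key‖ ≤ 1) :
    (x.1.clusters.length : ℝ) ≤ 10 * Real.exp d := by
  obtain ⟨h1, h2⟩ := subGen_centers l x hx hl
  set D := x.1.clusters.map Cluster.center with hD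
  have h3 : x.1.clusters.length = D.length := by simp [hD]
  rw [h3]
  refine card_le_of_separated D.get (fun i => h1 _ (List.get_mem _ i)) fun i j hij => ?_
  rcases lt_or_gt_of_ne hij with h | h
  · exact List.pairwise_iff_get.1 h2 i j h
  · rw [norm_sub_rev]
    exact List.pairwise_iff_get.1 h2 j i h

/-! ### Encoding the memory in bits -/

/-- The vector with `b`-bit precision that is encoded by `2 b + 2` bits per coordinate. -/
def decodeVec {d : ℕ} (b : ℕ) (c : Fin d → Fin (2 ^ (2 * b + 2))) : Vec d :=
  WithLp.toLp 2 fun j => (((c j : ℕ) : ℝ) - 4 ^ b) / 2 ^ b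

theorem exists_decodeVec {d b : ℕ} {u : Vec d} (hu : HasPrecision b u) :
    ∃ c, decodeVec b c = u := by
  choose z hz hzu using hu
  have hb : (2 : ℤ) ^ (2 * b + 2) = 4 * 4 ^ b := by
    rw [pow_add, pow_mul]; norm_num; ring
  have hpos : (0 : ℤ) < 4 ^ b := by positivity
  have h0 : ∀ j, 0 ≤ z j + 4 ^ b := fun j => by linarith [(abs_le.1 (hz j)).1]
  refine ⟨fun j => ⟨(z j + 4 ^ b).toNat, ?_⟩, ?_⟩
  · zify
    rw [Int.toNat_of_nonneg (h0 j), hb]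
    linarith [(abs_le.1 (hz j)).2]
  · ext j
    simp only [decodeVec, hzu]
    have h1 : (((z j + 4 ^ b).toNat : ℕ) : ℝ) = ((((z j + 4 ^ b).toNat : ℕ) : ℤ) : ℝ) := by
      norm_cast
    rw [h1, Int.toNat_of_nonneg (h0 j)]
    push_cast
    ring

/-- The bit-encoded contents of one cluster: center, counter and samples. -/
abbrev ClusterCode (d t b m : ℕ) : Type :=
  (Fin d → Fin (2 ^ (2 * b + 2))) × Fin (2 ^ m) × (Fin t → Fin d → Fin (2 ^ (2 * b + 2)))

/-- Bit-encoded memory of SubGen: `N` slots for clusters, the number of slots in use, the mass in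
units of `4 ^ (-b)`, and the sampled pairs. -/
abbrev SubGenCode (d t s b m N : ℕ) : Type :=
  (Fin N → ClusterCode d t b m) × Fin (2 ^ N) × Fin (2 ^ (m + d + 4 * b)) ×
    (Fin s → (Fin d → Fin (2 ^ (2 * b + 2))) × (Fin d → Fin (2 ^ (2 * b + 2))))

def decodeCluster {d t b m : ℕ} (c : ClusterCode d t b m) : Cluster d t :=
  ⟨decodeVec b c.1, c.2.1, fun j => decodeVec b (c.2.2 j)⟩

def decodeState {d t s b m N : ℕ} (c : SubGenCode d t s b m N) : SubGenState d t s where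
  clusters := (List.ofFn fun i => decodeCluster (c.1 i)).take c.2.1
  mass := (c.2.2.1 : ℕ) / 4 ^ b
  pairs j := (decodeVec b (c.2.2.2 j).1, decodeVec b (c.2.2.2 j).2)

theorem card_subGenCode (d t s b m N : ℕ) : Fintype.card (SubGenCode d t s b m N) =
    2 ^ (N * ((2 * b + 2) * d + m + t * ((2 * b + 2) * d)) + N + (m + d + 4 * b) +
      s * (2 * ((2 * b + 2) * d))) := by
  simp only [Fintype.card_prod, Fintype.card_fun, Fintype.card_fin]
  simp only [← pow_mul, ← pow_add]
  congr 1
  ring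

/-- The states of SubGen with `b`-bit entries after at most `n` updates. -/
structure SubGenState.IsPrecise {d t s : ℕ} (b n : ℕ) (S : SubGenState d t s) : Prop where
  center : ∀ c ∈ S.clusters, HasPrecision b c.center
  count : ∀ c ∈ S.clusters, c.count ≤ n
  samples : ∀ c ∈ S.clusters, ∀ j, HasPrecision b (c.samples j)
  mass : ∃ M : ℕ, M ≤ n * (d * 16 ^ b) ∧ S.mass = M / 4 ^ b
  pairs : ∀ j, HasPrecision b (S.pairs j).1 ∧ HasPrecision b (S.pairs j).2

theorem HasPrecision.zero {d b : ℕ} : HasPrecision b (0 : Vec d) :=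
  fun _ => ⟨0, by simp, by simp⟩

theorem HasPrecision.exists_normSq {d b : ℕ} {u : Vec d} (hu : HasPrecision b u) :
    ∃ M : ℕ, M ≤ d * 16 ^ b ∧ ‖u‖₊ ^ 2 = (M : ℝ≥0) / 4 ^ b := by
  choose z hz hzu using hu
  refine ⟨∑ j, (z j).natAbs ^ 2, ?_, ?_⟩
  · calc ∑ j, (z j).natAbs ^ 2 ≤ ∑ _j : Fin d, 16 ^ b := by
          refine Finset.sum_le_sum fun j _ => ?_
          have h1 : (z j).natAbs ≤ 4 ^ b := by
            zify; exact hz j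
          calc (z j).natAbs ^ 2 ≤ (4 ^ b) ^ 2 := Nat.pow_le_pow_left h1 2
            _ = 16 ^ b := by rw [← pow_mul, mul_comm, pow_mul]; norm_num
      _ = d * 16 ^ b := by simp
  · apply NNReal.eq
    push_cast
    rw [EuclideanSpace.norm_sq_eq, Finset.sum_div]
    refine Finset.sum_congr rfl fun j _ => ?_
    rw [hzu, Real.norm_eq_abs, sq_abs, div_pow, ← pow_mul, mul_comm b 2, pow_mul]
    norm_num

theorem subGen_isPrecise {d t s b : ℕ} {δ : ℝ} (l : List (Token d)) :
    ∀ x ∈ ((subGen d t s δ).run l).support, (∀ a ∈ l, a ∈ preciseTokens d b) →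
      x.1.IsPrecise b l.length := by
  refine StreamAlg.run_invariant _ (P := fun l (S : SubGenState d t s) =>
    (∀ a ∈ l, a ∈ preciseTokens d b) → S.IsPrecise b l.length) ?_ ?_ l
  · intro S hS _
    simp only [subGen, PMF.support_pure, Set.mem_singleton_iff] at hS
    subst hS
    constructor <;> simp [SubGenState.empty, HasPrecision.zero]
  · intro l a S hS x hx hl
    have hS := hS fun a ha => hl a (List.mem_append_left _ ha)
    obtain ⟨-, -, hk, hv⟩ : a ∈ preciseTokens d b := hl a (by simp)
    obtain ⟨-, hmass, hpairs, hcl⟩ := mem_support_subGen_step hx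
    -- every cluster of the new list is an old one, a new one, or an old one with `k` added
    have hnew : ∀ c ∈ x.1.clusters, HasPrecision b c.center ∧ c.count ≤ l.length + 1 ∧
        ∀ j, HasPrecision b (c.samples j) := by
      rcases hcl with ⟨-, h⟩ | ⟨i, -, e, h⟩
      · rw [h]
        intro c hc
        rcases List.mem_append.1 hc with hc | hc
        · exact ⟨hS.center c hc, (hS.count c hc).trans (Nat.le_succ _), hS.samples c hc⟩
        · rw [List.mem_singleton.1 hc]
          exact ⟨hk, by simp, fun _ => hk⟩
      · rw [h]
        intro c hc
        rcases List.mem_or_eq_of_mem_set hc with hc | rfl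
        · exact ⟨hS.center c hc, (hS.count c hc).trans (Nat.le_succ _), hS.samples c hc⟩
        · have hi := List.get_mem S.clusters i
          refine ⟨hS.center (S.clusters.get i) hi, Nat.succ_le_succ (hS.count _ hi), fun j => ?_⟩
          by_cases hb : e j
          · simpa [hb] using hk
          · simpa [hb] using hS.samples _ hi j
    refine ⟨fun c hc => (hnew c hc).1, fun c hc => ?_, fun c hc => (hnew c hc).2.2, ?_, fun j => ?_⟩
    · simpa using (hnew c hc).2.1
    · obtain ⟨M, hM, hM'⟩ := hS.mass
      obtain ⟨M2, hM2, hM2'⟩ := hv.exists_normSq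
      refine ⟨M + M2, ?_, ?_⟩
      · rw [List.length_append, List.length_singleton, add_mul, one_mul]
        exact add_le_add hM hM2
      · rw [hmass, hM', hM2']
        push_cast
        rw [add_div]
    · rcases hpairs j with h | h
      · rw [h]; exact ⟨hk, hv⟩
      · rw [h]; exact hS.pairs j

theorem SubGenState.IsPrecise.exists_decode {d t s b n m N : ℕ} {S : SubGenState d t s}
    (hS : S.IsPrecise b n) (hn : n < 2 ^ m) (hN : S.clusters.length ≤ N) :
    ∃ c : SubGenCode d t s b m N, decodeState c = S := by
  have hcl : ∀ i : Fin N, ∃ c : ClusterCode d t b m,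
      ∀ h : (i : ℕ) < S.clusters.length, decodeCluster c = S.clusters[(i : ℕ)] := by
    intro i
    by_cases h : (i : ℕ) < S.clusters.length
    · have hmem := List.getElem_mem h
      obtain ⟨c1, h1⟩ := exists_decodeVec (hS.center _ hmem)
      choose c2 h2 using fun j => exists_decodeVec (hS.samples _ hmem j)
      refine ⟨(c1, ⟨S.clusters[(i : ℕ)].count, (hS.count _ hmem).trans_lt hn⟩, c2), fun _ => ?_⟩
      simp [decodeCluster, h1, h2]
    · exact ⟨(fun _ => ⟨0, by positivity⟩, ⟨0, by positivity⟩, fun _ _ => ⟨0, by positivity⟩),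
        fun h' => absurd h' h⟩
  choose f hf using hcl
  obtain ⟨M, hM, hM'⟩ := hS.mass
  choose p1 hp1 using fun j => exists_decodeVec (hS.pairs j).1
  choose p2 hp2 using fun j => exists_decodeVec (hS.pairs j).2
  have hMlt : M < 2 ^ (m + d + 4 * b) := by
    refine hM.trans_lt ?_
    rw [pow_add, pow_add, pow_mul, mul_assoc]
    have h16 : (16 : ℕ) ^ b = (2 ^ 4) ^ b := by norm_num
    rw [h16]
    exact Nat.mul_lt_mul_of_lt_of_le hn (Nat.mul_le_mul_right _ Nat.lt_two_pow_self.le)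
      (by positivity)
  refine ⟨(f, ⟨S.clusters.length, hN.trans_lt Nat.lt_two_pow_self⟩, ⟨M, hMlt⟩,
    fun j => (p1 j, p2 j)), ?_⟩
  have hlist : (List.ofFn fun i => decodeCluster (f i)).take S.clusters.length = S.clusters := by
    refine List.ext_getElem (by simpa using hN) fun j h1 h2 => ?_
    simp only [List.getElem_take, List.getElem_ofFn]
    exact hf ⟨j, h2.trans_le hN⟩ h2
  simp only [decodeState, hlist, hp1, hp2, ← hM', Prod.mk.eta]

/-- A set of states that is covered by a decoding of at most `2 ^ B` codes fits into `B` bits. -/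
theorem exists_injOn_of_decode {σ X : Type*} [Fintype X] {B : ℕ} (hX : Fintype.card X = 2 ^ B)
    (dec : X → σ) {R : Set σ} (hR : ∀ x ∈ R, ∃ c, dec c = x) :
    ∃ enc : σ → (Fin B → Bool), Set.InjOn enc R := by
  classical
  have e : X ≃ (Fin B → Bool) := Fintype.equivOfCardEq (by simp [hX])
  refine ⟨fun x => if h : ∃ c, dec c = x then e h.choose else fun _ => false, ?_⟩
  intro x hx y hy hxy
  have hx' := hR x hx
  have hy' := hR y hy
  simp only [dif_pos hx', dif_pos hy'] at hxy
  rw [← hx'.choose_spec, ← hy'.choose_spec, e.injective hxy]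

/-- The number of bits in which `N` clusters and the rest of the memory of SubGen can be kept for
`b`-bit entries and counters of `m` bits. -/
def subGenBits (d t s b m N : ℕ) : ℕ :=
  N * ((2 * b + 2) * d + m + t * ((2 * b + 2) * d)) + N + (m + d + 4 * b) +
    s * (2 * ((2 * b + 2) * d))

theorem subGen_usesBits {d t s b n m N : ℕ} (hn : n < 2 ^ m)
    (hN : ⌊10 * Real.exp d⌋₊ ≤ N) :
    (subGen d t s (Real.exp 1 / 3)).UsesBits n (preciseTokens d b) (subGenBits d t s b m N) := by
  refine exists_injOn_of_decode (card_subGenCode d t s b m N) decodeState ?_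
  rintro S ⟨l, hl, hlT, y, hy⟩
  refine (subGen_isPrecise l _ hy hlT).exists_decode (hl.trans_lt hn) ?_
  exact (Nat.le_floor (subGen_clusters_length_le hy fun a ha => (hlT a ha).1)).trans hN

/-! ### The size of the memory -/

section Size

variable {d t s : ℕ} {A R Y : ℝ}

theorem subGen_words_le (hd : 1 ≤ d) (hA : 0 ≤ A) (hR : 1 ≤ R) (hY : 1 ≤ Y)
    (ht : (t : ℝ) ≤ A * R * Y) (hs : (s : ℝ) ≤ A * R * d) {S : SubGenState d t s}
    (hS : (S.clusters.length : ℝ) ≤ 10 * Real.exp d) :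
    (S.words : ℝ) ≤ (68 + 24 * A) * R * (d * Real.exp d) * Y := by
  have hd1 : (1 : ℝ) ≤ d := by exact_mod_cast hd
  have hE : (d : ℝ) ≤ Real.exp d := by linarith [Real.add_one_le_exp (d : ℝ)]
  set E := Real.exp d
  have hE1 : 1 ≤ E := hd1.trans hE
  rw [SubGenState.words]
  push_cast
  have hRY : 1 ≤ R * Y := one_le_mul_of_one_le_of_one_le hR hY
  have hdE : 1 ≤ d * E := one_le_mul_of_one_le_of_one_le hd1 hE1
  have hX1 : 1 ≤ d * E * (R * Y) := one_le_mul_of_one_le_of_one_le hdE hRY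
  have hX2 : d * E ≤ d * E * (R * Y) := le_mul_of_one_le_right (by positivity) hRY
  have h1 : (S.clusters.length : ℝ) * (d + 1 + t * d) ≤
      10 * E * (d + d + (A * R * Y) * d) := by gcongr
  have h2 : (s : ℝ) * (2 * d) ≤ A * R * d * (2 * E) := by gcongr
  have h3 : A * R * d * (2 * E) ≤ A * R * d * (2 * E) * Y :=
    le_mul_of_one_le_right (by positivity) hY
  have h4 : 0 ≤ A * (d * E * (R * Y)) := by positivity
  nlinarith

theorem subGenBits_le {b m N : ℕ} (hd : 1 ≤ d) (hA : 0 ≤ A) (hR : 1 ≤ R) (hY : 1 ≤ Y)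
    (ht : (t : ℝ) ≤ A * R * Y) (hs : (s : ℝ) ≤ A * R * d) (hm : (m : ℝ) ≤ 3 * Y)
    (hN : (N : ℝ) ≤ 10 * Real.exp d) :
    (subGenBits d t s b m N : ℝ) ≤ (b + 1) * ((68 + 24 * A) * R * (d * Real.exp d) * Y) := by
  have hd1 : (1 : ℝ) ≤ d := by exact_mod_cast hd
  have hE : (d : ℝ) ≤ Real.exp d := by linarith [Real.add_one_le_exp (d : ℝ)]
  set E := Real.exp d
  have hE1 : 1 ≤ E := hd1.trans hE
  rw [subGenBits]
  push_cast
  set β : ℝ := (b : ℝ) + 1 with hβ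
  have hβ1 : 1 ≤ β := by rw [hβ]; linarith [(Nat.cast_nonneg b : (0 : ℝ) ≤ b)]
  have hb : (b : ℝ) ≤ β := by linarith
  have h2b : 2 * (b : ℝ) + 2 = 2 * β := by rw [hβ]; ring
  rw [h2b]
  set Q := β * (R * (d * E) * Y) with hQ
  have hRY : 1 ≤ R * Y := one_le_mul_of_one_le_of_one_le hR hY
  have hβRY : 1 ≤ β * (R * Y) := one_le_mul_of_one_le_of_one_le hβ1 hRY
  have hdE : 1 ≤ d * E := one_le_mul_of_one_le_of_one_le hd1 hE1
  -- each kind of item is bounded by a multiple of `Q`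
  have q1 : E * (β * d) ≤ Q := by
    calc E * (β * d) ≤ E * (β * d) * (R * Y) := le_mul_of_one_le_right (by positivity) hRY
      _ = Q := by rw [hQ]; ring
  have q2 : E * Y ≤ Q := by
    calc E * Y ≤ E * Y * (β * R * d) := le_mul_of_one_le_right (by positivity)
          (one_le_mul_of_one_le_of_one_le (one_le_mul_of_one_le_of_one_le hβ1 hR) hd1)
      _ = Q := by rw [hQ]; ring
  have q3 : β ≤ Q := by
    calc β ≤ β * (R * (d * E) * Y) := le_mul_of_one_le_right (by positivity)
          (one_le_mul_of_one_le_of_one_le (one_le_mul_of_one_le_of_one_le hR hdE) hY)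
      _ = Q := rfl
  have q4 : Y ≤ E * Y := le_mul_of_one_le_left (by positivity) hE1
  have q5 : E ≤ E * Y := le_mul_of_one_le_right (by positivity) hY
  have q6 : R * d * (β * d) ≤ Q := by
    calc R * d * (β * d) ≤ R * d * (β * E) := by gcongr
      _ ≤ R * d * (β * E) * Y := le_mul_of_one_le_right (by positivity) hY
      _ = Q := by rw [hQ]; ring
  have h1 : (N : ℝ) * (2 * β * d + m + t * (2 * β * d)) ≤
      10 * E * (2 * β * d + 3 * Y + A * R * Y * (2 * β * d)) := by gcongr
  have h2 : 10 * E * (2 * β * d + 3 * Y + A * R * Y * (2 * β * d)) =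
      20 * (E * (β * d)) + 30 * (E * Y) + 20 * (A * Q) := by rw [hQ]; ring
  have h3 : (s : ℝ) * (2 * (2 * β * d)) ≤ A * R * d * (2 * (2 * β * d)) := by gcongr
  have h4 : A * R * d * (2 * (2 * β * d)) = 4 * (A * (R * d * (β * d))) := by ring
  have h5 := mul_le_mul_of_nonneg_left q6 hA
  have h6 : β * ((68 + 24 * A) * R * (d * E) * Y) = 68 * Q + 24 * (A * Q) := by
    rw [hQ]; ring
  rw [h6]
  linarith

end Size

/-! ### The upper bound -/

/-- A query norm `O(log log n)` makes the factor `exp (2 δ r)` polylogarithmic. -/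
theorem exp_mul_le_log_pow {n : ℕ} (hn : 3 ≤ n) {κ K ρ : ℝ} (hκ : 0 ≤ κ)
    (hρ : ‖ρ‖ ≤ K * ‖Real.log (Real.log n)‖) : Real.exp (κ * ρ) ≤ Real.log n ^ ⌈κ * K⌉₊ := by
  have hlog := one_le_log_of_three_le hn
  have hll : 0 ≤ Real.log (Real.log n) := Real.log_nonneg hlog
  have h0 : 0 < Real.log n := by linarith
  rw [Real.norm_of_nonneg hll] at hρ
  calc Real.exp (κ * ρ) ≤ Real.exp (⌈κ * K⌉₊ * Real.log (Real.log n)) := by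
        refine Real.exp_le_exp.2 ?_
        calc κ * ρ ≤ κ * (K * Real.log (Real.log n)) :=
              mul_le_mul_of_nonneg_left ((le_abs_self ρ).trans hρ) hκ
          _ = κ * K * Real.log (Real.log n) := by ring
          _ ≤ _ := mul_le_mul_of_nonneg_right (Nat.le_ceil _) hll
    _ = Real.log n ^ ⌈κ * K⌉₊ := by
        rw [mul_comm, Real.exp_mul, Real.exp_log h0, Real.rpow_natCast]

theorem natLog_two_add_one_le {n : ℕ} (hn : 3 ≤ n) :
    ((Nat.log 2 n + 1 : ℕ) : ℝ) ≤ 3 * Real.log n := by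
  have hlog := one_le_log_of_three_le hn
  have h1 : (Nat.log 2 n : ℝ) * Real.log 2 ≤ Real.log n := by
    rw [← Real.log_pow]
    refine Real.log_le_log (by positivity) ?_
    exact_mod_cast Nat.pow_log_le_self 2 (by omega)
  have h2 := Real.log_two_gt_d9
  have h3 : (0 : ℝ) ≤ Nat.log 2 n := by positivity
  push_cast
  nlinarith

theorem tunedSubGen_upper_bound : ∃ a : ℝ, 0 < a ∧
      ∀ r : ℕ → ℝ, (r =O[atTop] fun n : ℕ => Real.log (Real.log n)) →
      ∃ (C : ℝ) (c : ℕ),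
      ∀ d : ℕ → ℕ, (∀ n, 2 ≤ d n) →
      ∀ᶠ n : ℕ in atTop, ∀ ε : ℝ, 0 < ε → ε < 1 →
        (∀ (i : ℕ) (hi : 0 < i), i ≤ n → ∀ x : Fin i → Token (d n),
          (∀ l, ‖(x l).key‖ ≤ 1) → (∀ l, ‖(x l).query‖ ≤ r n) →
          99 / 100 ≤ (tunedSubGen a ε (Real.exp 1 / 3) (r n) n (d n)).outputProb x
            (IsSpectralApprox ε hi x)) ∧
        (∀ σ ∈ (tunedSubGen a ε (Real.exp 1 / 3) (r n) n (d n)).reachable n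
            {x | ‖x.key‖ ≤ 1},
          (σ.words : ℝ) ≤ C * (ε ^ 2)⁻¹ * (d n * Real.exp (d n)) * Real.log n ^ c) ∧
        (∀ b : ℕ, ∃ B : ℕ,
          (B : ℝ) ≤ (b + 1) * (C * (ε ^ 2)⁻¹ * (d n * Real.exp (d n)) * Real.log n ^ c) ∧
          (tunedSubGen a ε (Real.exp 1 / 3) (r n) n (d n)).UsesBits n
            (preciseTokens (d n) b) B) := by
  refine ⟨25600, by norm_num, fun r hr => ?_⟩
  obtain ⟨K, hK⟩ := hr.bound
  set κ : ℝ := 2 * (Real.exp 1 / 3) with hκ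
  have hκ0 : 0 ≤ κ := by positivity
  refine ⟨68 + 24 * 25601, ⌈κ * K⌉₊ + 1, fun d hd => ?_⟩
  filter_upwards [hK, eventually_ge_atTop 3] with n hrn hn ε hε hε1
  have hdn : 1 ≤ d n := one_le_two.trans (hd n)
  have hd1 : (1 : ℝ) ≤ d n := by exact_mod_cast hdn
  have hlog := one_le_log_of_three_le hn
  have hR : 1 ≤ (ε ^ 2)⁻¹ := (one_le_inv₀ (by positivity)).2 (by nlinarith)
  have hY : 1 ≤ Real.log n ^ (⌈κ * K⌉₊ + 1) := one_le_pow₀ hlog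
  -- the ceilings in the sample sizes are absorbed by increasing the constant by one
  have hs : (pairSamples 25600 ε (d n) : ℝ) ≤ 25601 * (ε ^ 2)⁻¹ * d n := by
    refine (Nat.ceil_lt_add_one (by positivity)).le.trans ?_
    have : 1 ≤ (ε ^ 2)⁻¹ * d n := one_le_mul_of_one_le_of_one_le hR hd1
    linarith
  have ht : (clusterSamples 25600 ε (Real.exp 1 / 3) (r n) n : ℝ) ≤
      25601 * (ε ^ 2)⁻¹ * Real.log n ^ (⌈κ * K⌉₊ + 1) := by
    refine (Nat.ceil_lt_add_one (by positivity)).le.trans ?_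
    have h1 := exp_mul_le_log_pow hn hκ0 hrn
    rw [hκ] at h1
    have h2 : 25600 * (ε ^ 2)⁻¹ * Real.exp (2 * (Real.exp 1 / 3) * r n) * Real.log n ≤
        25600 * (ε ^ 2)⁻¹ * Real.log n ^ ⌈κ * K⌉₊ * Real.log n := by
      gcongr
    have h3 : 1 ≤ (ε ^ 2)⁻¹ * Real.log n ^ (⌈κ * K⌉₊ + 1) :=
      one_le_mul_of_one_le_of_one_le hR hY
    rw [pow_succ (Real.log n)] at h3 ⊢
    linarith
  refine ⟨fun i hi _ x _ hq => ?_, ?_, fun b => ?_⟩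
  · exact tunedSubGen_accuracy le_rfl hn hdn (by positivity) hε hε1 hi x hq
  · rintro S ⟨l, -, hl, y, hy⟩
    exact subGen_words_le hdn (by norm_num) hR hY ht hs (subGen_clusters_length_le hy hl)
  · refine ⟨_, ?_, subGen_usesBits (m := Nat.log 2 n + 1) (Nat.lt_pow_succ_log_self one_lt_two n)
      le_rfl⟩
    refine subGenBits_le hdn (by norm_num) hR hY ht hs ?_ (Nat.floor_le (by positivity))
    refine (natLog_two_add_one_le hn).trans ?_
    refine mul_le_mul_of_nonneg_left ?_ (by norm_num)
    exact le_self_pow₀ hlog (Nat.succ_ne_zero _)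

/-! ### Memory needed to recover most symbols of a word -/

/-- If every word of `N` symbols from an alphabet of size `2 ^ d` agrees in `4 / 5` of its places
with one of `2 ^ B` words, then `B` is at least `(4 / 5) d N - N`. Weighting each agreement of
two words by the factor `2 ^ d` turns the sum over all words into a product over the places. -/
theorem mul_le_of_covering {N d B : ℕ} {X : Type*} [Fintype X] [DecidableEq X]
    (hX : Fintype.card X = 2 ^ d) (Y : (Fin B → Bool) → Fin N → X)
    (hY : ∀ v : Fin N → X, ∃ c, 4 * N ≤ 5 * (Finset.univ.filter fun i => v i = Y c i).card) :
    4 * (d * N) ≤ 5 * (B + N) := by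
  set k := (4 * N + 4) / 5 with hk
  have hagree : ∀ (v : Fin N → X) c, ∏ i, (if v i = Y c i then 2 ^ d else 1) =
      (2 ^ d) ^ (Finset.univ.filter fun i => v i = Y c i).card := by
    intro v c
    rw [Finset.prod_ite]
    simp
  have h1 : ∀ v : Fin N → X, (2 ^ d) ^ k ≤ ∑ c, ∏ i, (if v i = Y c i then 2 ^ d else 1) := by
    intro v
    obtain ⟨c, hc⟩ := hY v
    refine le_trans ?_ (Finset.single_le_sum (fun c _ => Nat.zero_le _) (Finset.mem_univ c))
    rw [hagree]
    exact Nat.pow_le_pow_right (by positivity) (by omega)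
  have h2 : ∀ c, ∑ v : Fin N → X, ∏ i, (if v i = Y c i then 2 ^ d else 1) ≤
      (2 ^ (d + 1)) ^ N := by
    intro c
    rw [← Fintype.prod_sum fun (i : Fin N) (u : X) => if u = Y c i then 2 ^ d else 1]
    refine (Finset.prod_le_pow_card _ _ (2 ^ (d + 1)) fun i _ => ?_).trans (by simp)
    calc ∑ u : X, (if u = Y c i then 2 ^ d else 1) ≤
          ∑ u : X, ((if u = Y c i then 2 ^ d else 0) + 1) :=
          Finset.sum_le_sum fun u _ => by split_ifs <;> omega
      _ = 2 ^ (d + 1) := by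
          rw [Finset.sum_add_distrib, Finset.sum_ite_eq']
          simp [hX]; ring
  have h3 : 2 ^ (d * N) * (2 ^ d) ^ k ≤ 2 ^ B * (2 ^ (d + 1)) ^ N := by
    calc 2 ^ (d * N) * (2 ^ d) ^ k = ∑ _v : Fin N → X, (2 ^ d) ^ k := by
          simp [hX, pow_mul]
      _ ≤ ∑ v : Fin N → X, ∑ c, ∏ i, (if v i = Y c i then 2 ^ d else 1) :=
          Finset.sum_le_sum fun v _ => h1 v
      _ = ∑ c, ∑ v : Fin N → X, ∏ i, (if v i = Y c i then 2 ^ d else 1) := Finset.sum_comm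
      _ ≤ ∑ _c : Fin B → Bool, (2 ^ (d + 1)) ^ N := Finset.sum_le_sum fun c _ => h2 c
      _ = _ := by simp
  rw [← pow_mul, ← pow_mul, ← pow_add, ← pow_add, Nat.pow_le_pow_iff_right one_lt_two] at h3
  have h4 : 4 * N ≤ 5 * k := by omega
  have h5 := Nat.mul_le_mul_left d h4
  nlinarith

/-- A state from which the symbols are guessed correctly with average probability `9 / 10` has at
least `4 / 5` of the symbols with probability above `1 / 2`. -/
theorem card_gt_half_of_sum_ge {N : ℕ} {ρ : Fin N → ℝ≥0∞} (hρ : ∀ i, ρ i ≤ 1)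
    (h : (N : ℝ≥0∞) * (9 / 10) ≤ ∑ i, ρ i) :
    4 * N ≤ 5 * (Finset.univ.filter fun i => 1 / 2 < ρ i).card := by
  have hfin : ∀ i, ρ i ≠ ⊤ := fun i => ne_top_of_le_ne_top ENNReal.one_ne_top (hρ i)
  have h1 : (N : ℝ) * (9 / 10) ≤ ∑ i, (ρ i).toReal := by
    have := ENNReal.toReal_mono (ENNReal.sum_ne_top.2 fun i _ => hfin i) h
    rw [ENNReal.toReal_sum fun i _ => hfin i] at this
    simpa using this
  have h2 : ∑ i, (ρ i).toReal ≤ ∑ i : Fin N, ((if 1 / 2 < ρ i then 1 / 2 else 0) + 1 / 2 : ℝ) := by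
    refine Finset.sum_le_sum fun i _ => ?_
    split_ifs with hi
    · have := ENNReal.toReal_mono ENNReal.one_ne_top (hρ i)
      rw [ENNReal.toReal_one] at this
      linarith
    · have := ENNReal.toReal_mono (by simp) (not_lt.1 hi)
      simpa using this
  rw [Finset.sum_add_distrib, ← Finset.sum_filter] at h2
  simp only [Finset.sum_const, nsmul_eq_mul, Finset.card_univ, Fintype.card_fin] at h2
  have h3 : (4 * N : ℝ) ≤ 5 * (Finset.univ.filter fun i => 1 / 2 < ρ i).card := by linarith
  exact_mod_cast h3

/-- A random variable whose mean is at least `c` attains a value of at least `c`. -/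
theorem exists_le_of_le_tsum {σ : Type*} (p : PMF σ) (f : σ → ℝ≥0∞) {c : ℝ≥0∞} (hc : c ≠ ⊤)
    (h : c ≤ ∑' s, p s * f s) : ∃ s ∈ p.support, c ≤ f s := by
  by_contra! hlt
  obtain ⟨s, hs⟩ := p.support_nonempty
  have hle : ∀ s, p s * f s ≤ p s * c := by
    intro s
    by_cases hs : s ∈ p.support
    · exact mul_le_mul_right (hlt s hs).le _
    · rw [(PMF.apply_eq_zero_iff p s).2 hs]; simp
  have hsum : ∑' s, p s * c = c := by rw [ENNReal.tsum_mul_right, p.tsum_coe, one_mul]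
  have hne : ∑' s, p s * f s ≠ ⊤ :=
    ne_top_of_le_ne_top hc ((ENNReal.tsum_le_tsum hle).trans hsum.le)
  have hs0 : p s ≠ 0 := (PMF.mem_support_iff _ _).1 hs
  have := ENNReal.tsum_lt_tsum (i := s) hne hle
    (ENNReal.mul_lt_mul_right hs0 (p.apply_ne_top s) (hlt s hs))
  rw [hsum] at this
  exact absurd h (not_le.2 this)

/-- The memory needed for the one-way index problem with shared alphabet `X`: the word `v` is
stored in a random state of law `p v`, and `ρ s i u` is the probability that the decoder guesses
`u` for the symbol `i` in state `s`. -/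
theorem mul_le_of_index {N d B : ℕ} {X σ : Type*} [Fintype X] [DecidableEq X] [Nonempty X]
    (hX : Fintype.card X = 2 ^ d) (p : (Fin N → X) → PMF σ) {R : Set σ}
    (hR : ∀ v, (p v).support ⊆ R) {enc : σ → (Fin B → Bool)} (henc : Set.InjOn enc R)
    (ρ : σ → Fin N → X → ℝ≥0∞) (hρ1 : ∀ s i u, ρ s i u ≤ 1)
    (hρ : ∀ s i u u', 1 / 2 < ρ s i u → 1 / 2 < ρ s i u' → u = u')
    (hsucc : ∀ v i, 9 / 10 ≤ ∑' s, p v s * ρ s i (v i)) :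
    4 * (d * N) ≤ 5 * (B + N) := by
  classical
  have hY : ∀ s i, ∃ y, ∀ u, 1 / 2 < ρ s i u → u = y := by
    intro s i
    by_cases h : ∃ u, 1 / 2 < ρ s i u
    · obtain ⟨y, hy⟩ := h
      exact ⟨y, fun u hu => hρ s i u y hu hy⟩
    · exact ⟨Classical.arbitrary X, fun u hu => absurd ⟨u, hu⟩ h⟩
  choose Y hY using hY
  have hdec : ∀ c : Fin B → Bool, ∃ y : Fin N → X, ∀ s ∈ R, enc s = c → Y s = y := by
    intro c
    by_cases h : ∃ s ∈ R, enc s = c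
    · obtain ⟨s, hs, hsc⟩ := h
      exact ⟨Y s, fun s' hs' hsc' => by rw [henc hs' hs (hsc'.trans hsc.symm)]⟩
    · exact ⟨fun _ => Classical.arbitrary X, fun s hs hsc => absurd ⟨s, hs, hsc⟩ h⟩
  choose Z hZ using hdec
  refine mul_le_of_covering hX Z fun v => ?_
  have hmean : (N : ℝ≥0∞) * (9 / 10) ≤ ∑' s, p v s * ∑ i, ρ s i (v i) := by
    calc (N : ℝ≥0∞) * (9 / 10) = ∑ _i : Fin N, (9 / 10 : ℝ≥0∞) := by simp
      _ ≤ ∑ i, ∑' s, p v s * ρ s i (v i) := Finset.sum_le_sum fun i _ => hsucc v i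
      _ = ∑' s, ∑ i, p v s * ρ s i (v i) :=
          (Summable.tsum_finsetSum fun i _ => ENNReal.summable).symm
      _ = _ := by simp only [Finset.mul_sum]
  obtain ⟨s, hs, hsum⟩ := exists_le_of_le_tsum (p v) _
    (ENNReal.mul_ne_top (ENNReal.natCast_ne_top N)
      (ENNReal.div_ne_top (by simp) (by simp))) hmean
  refine ⟨enc s, (card_gt_half_of_sum_ge (fun i => hρ1 s i (v i)) hsum).trans ?_⟩
  refine Nat.mul_le_mul_left _ (Finset.card_le_card fun i hi => ?_)
  rw [Finset.mem_filter] at hi ⊢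
  refine ⟨hi.1, ?_⟩
  rw [← hZ (enc s) s (hR v hs) rfl]
  exact hY s i (v i) hi.2

/-! ### Integer keys with a margin -/

/-- Eight lattice points on the circle of radius `√5`. -/
def octagon : Fin 8 → ℤ × ℤ :=
  ![(1, 2), (2, 1), (2, -1), (1, -2), (-1, -2), (-2, -1), (-2, 1), (-1, 2)]

def octagonDot (a b : Fin 8) : ℤ :=
  (octagon a).1 * (octagon b).1 + (octagon a).2 * (octagon b).2

theorem octagonDot_self : ∀ a, octagonDot a a = 5 := by decide

theorem octagonDot_le : ∀ a b, octagonDot a b ≤ 5 := by decide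

theorem octagonDot_le_of_ne : ∀ a b, a ≠ b → octagonDot a b ≤ 4 := by decide

theorem octagon_abs_le : ∀ a, |(octagon a).1| ≤ 2 ∧ |(octagon a).2| ≤ 2 := by decide

/-- The integer vector made of one octagon point for each of the `d / 2` pairs of consecutive
coordinates. For odd `d` the last coordinate is `0`. -/
def octagonVec {d : ℕ} (P : Fin (d / 2) → Fin 8) (j : ℕ) : ℤ :=
  if h : j / 2 < d / 2 then
    if j % 2 = 0 then (octagon (P ⟨j / 2, h⟩)).1 else (octagon (P ⟨j / 2, h⟩)).2
  else 0

theorem octagonVec_abs_le {d : ℕ} (P : Fin (d / 2) → Fin 8) (j : ℕ) : |octagonVec P j| ≤ 2 := by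
  rw [octagonVec]
  split_ifs
  · exact (octagon_abs_le _).1
  · exact (octagon_abs_le _).2
  · simp

theorem sum_range_two_mul (F : ℕ → ℤ) (m : ℕ) :
    ∑ j ∈ Finset.range (2 * m), F j = ∑ i ∈ Finset.range m, (F (2 * i) + F (2 * i + 1)) := by
  induction m with
  | zero => simp
  | succ m ih =>
    rw [Finset.sum_range_succ, ← ih, mul_add, mul_one, Finset.sum_range_succ,
      Finset.sum_range_succ, add_assoc]

theorem sum_octagonVec_mul {d : ℕ} (P Q : Fin (d / 2) → Fin 8) :
    ∑ j : Fin d, octagonVec P j * octagonVec Q j = ∑ i, octagonDot (P i) (Q i) := by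
  rw [Fin.sum_univ_eq_sum_range fun j => octagonVec P j * octagonVec Q j]
  have h1 : ∑ j ∈ Finset.range d, octagonVec P j * octagonVec Q j =
      ∑ j ∈ Finset.range (2 * (d / 2)), octagonVec P j * octagonVec Q j := by
    refine (Finset.sum_subset (Finset.range_mono (Nat.mul_div_le d 2)) fun j hj hj' => ?_).symm
    have : ¬ j / 2 < d / 2 := by
      rw [Finset.mem_range] at hj hj'
      omega
    simp [octagonVec, this]
  rw [h1, sum_range_two_mul, Finset.sum_range]
  refine Finset.sum_congr rfl fun i _ => ?_
  have e1 : (2 * (i : ℕ)) / 2 = i := by omega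
  have e2 : (2 * (i : ℕ) + 1) / 2 = i := by omega
  have e3 : (2 * (i : ℕ)) % 2 = 0 := by omega
  have e4 : (2 * (i : ℕ) + 1) % 2 = 1 := by omega
  simp [octagonVec, octagonDot, e1, e2, e4]

/-- There are `8 ^ (d / 2)` integer vectors with small coordinates, all of the same norm, whose
mutual inner products are smaller than their squared norm. -/
theorem exists_integer_vectors {d : ℕ} (hd : 2 ≤ d) :
    ∃ (u : Fin (8 ^ (d / 2)) → Fin d → ℤ) (S : ℤ), 1 ≤ S ∧ S ≤ 4 ^ d ∧
      (∀ i j, |u i j| ≤ 2) ∧ (∀ i, ∑ j, u i j * u i j = S) ∧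
      ∀ i i', i ≠ i' → ∑ j, u i j * u i' j ≤ S - 1 := by
  have e : Fin (8 ^ (d / 2)) ≃ (Fin (d / 2) → Fin 8) := Fintype.equivOfCardEq (by simp)
  refine ⟨fun i j => octagonVec (e i) j, 5 * (d / 2 : ℕ), ?_, ?_,
    fun i j => octagonVec_abs_le _ _, fun i => ?_, fun i i' hii' => ?_⟩
  · have : 1 ≤ d / 2 := by omega
    have : (1 : ℤ) ≤ (d / 2 : ℕ) := by exact_mod_cast this
    linarith
  · have h1 : d ≤ 2 ^ d := Nat.lt_two_pow_self.le
    have h2 : 2 ^ 2 ≤ 2 ^ d := Nat.pow_le_pow_right two_pos hd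
    have h3 : 2 ^ 2 * d ≤ 2 ^ d * 2 ^ d := Nat.mul_le_mul h2 h1
    rw [← mul_pow] at h3
    norm_num at h3
    have h4 : 5 * (d / 2) ≤ 4 ^ d := by omega
    exact_mod_cast h4
  · rw [sum_octagonVec_mul]
    simp [octagonDot_self, mul_comm]
  · rw [sum_octagonVec_mul]
    obtain ⟨a, ha⟩ : ∃ a, e i a ≠ e i' a := by
      by_contra! h
      exact hii' (e.injective (funext h))
    rw [← Finset.add_sum_erase _ _ (Finset.mem_univ a)]
    have h1 : ∑ x ∈ Finset.univ.erase a, octagonDot (e i x) (e i' x) ≤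
        ∑ _x ∈ Finset.univ.erase a, 5 := Finset.sum_le_sum fun x _ => octagonDot_le _ _
    have h2 := octagonDot_le_of_ne _ _ ha
    have h3 : 1 ≤ d / 2 := by omega
    rw [Finset.sum_const, Finset.card_erase_of_mem (Finset.mem_univ a), Finset.card_univ,
      Fintype.card_fin, nsmul_eq_mul, Nat.cast_sub h3] at h1
    push_cast at h1 ⊢
    linarith

/-! ### Reading a value off the attention -/

/-- If one weight dominates, the attention is close to the corresponding value. -/
theorem attn_bounds {n d : ℕ} (q : Vec d) (x : Fin n → Token d) (i : Fin n)
    (hv : ∀ l j, 0 ≤ (x l).value j ∧ (x l).value j ≤ 1)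
    (hw : ∀ l, l ≠ i →
      n * (n * keyWeight q (x l).key) ≤ keyWeight q (x i).key) (j : Fin d) :
    ((x i).value j = 1 → 1 / 2 ≤ attn q (keyMatrix x) (valueMatrix x) j) ∧
      ((x i).value j = 0 → attn q (keyMatrix x) (valueMatrix x) j ≤ 1 / n) := by
  have hn1 : (1 : ℝ) ≤ n := by exact_mod_cast i.pos
  have hn0 : (0 : ℝ) < n := by linarith
  set w : Fin n → ℝ := fun l => keyWeight q (x l).key with hwdef
  have hw0 : ∀ l, 0 < w l := fun l => keyWeight_pos _ _
  set W := ∑ l, w l with hW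
  have hrest : ∑ l ∈ Finset.univ.erase i, w l ≤ w i / n := by
    calc ∑ l ∈ Finset.univ.erase i, w l ≤ ∑ _l ∈ Finset.univ.erase i, w i / (n * n) := by
          refine Finset.sum_le_sum fun l hl => ?_
          rw [le_div_iff₀ (by positivity)]
          have := hw l (Finset.ne_of_mem_erase hl)
          linarith
      _ ≤ n * (w i / (n * n)) := by
          rw [Finset.sum_const, nsmul_eq_mul]
          refine mul_le_mul_of_nonneg_right ?_ (div_nonneg (hw0 i).le (by positivity))
          exact_mod_cast (Finset.card_le_univ _).trans (by simp)
      _ = w i / n := by field_simp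
  have hWsplit : W = w i + ∑ l ∈ Finset.univ.erase i, w l :=
    (Finset.add_sum_erase _ _ (Finset.mem_univ i)).symm
  have hrest0 : 0 ≤ ∑ l ∈ Finset.univ.erase i, w l := Finset.sum_nonneg fun l _ => (hw0 l).le
  have hWpos : 0 < W := by linarith [hw0 i]
  have hattn : attn q (keyMatrix x) (valueMatrix x) j =
      (w i * (x i).value j + ∑ l ∈ Finset.univ.erase i, w l * (x l).value j) / W := by
    rw [attn_eq, exactNormalizer_ofFn, exactNumerator_ofFn, PiLp.smul_apply, WithLp.ofLp_sum,
      Finset.sum_apply, ← Finset.add_sum_erase _ _ (Finset.mem_univ i), smul_eq_mul, div_eq_inv_mul]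
    simp [w, W]
  have hsum0 : 0 ≤ ∑ l ∈ Finset.univ.erase i, w l * (x l).value j :=
    Finset.sum_nonneg fun l _ => mul_nonneg (hw0 l).le (hv l j).1
  have hsum1 : ∑ l ∈ Finset.univ.erase i, w l * (x l).value j ≤ w i / n :=
    (Finset.sum_le_sum fun l _ => mul_le_of_le_one_right (hw0 l).le (hv l j).2).trans hrest
  have hwn : w i / n ≤ w i := div_le_self (hw0 i).le hn1
  rw [hattn]
  constructor
  · intro h
    rw [h, mul_one, le_div_iff₀ hWpos]
    linarith
  · intro h
    rw [h, mul_zero, zero_add, div_le_iff₀ hWpos]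
    refine hsum1.trans ?_
    rw [div_eq_inv_mul, one_div]
    exact mul_le_mul_of_nonneg_left (by linarith) (by positivity)

theorem HasPrecision.of_int {d b : ℕ} {u : Vec d} {z : Fin d → ℤ} (hz : ∀ j, |z j| ≤ 2 ^ b)
    (hu : ∀ j, u j = z j) : HasPrecision b u := by
  refine fun j => ⟨z j * 2 ^ b, ?_, ?_⟩
  · rw [abs_mul, abs_of_pos (by positivity : (0 : ℤ) < 2 ^ b)]
    calc |z j| * 2 ^ b ≤ 2 ^ b * 2 ^ b := mul_le_mul_of_nonneg_right (hz j) (by positivity)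
      _ = 4 ^ b := by rw [← mul_pow]; norm_num
  · rw [hu]; push_cast; field_simp

/-! ### The lower bound -/

/-- The vector of zeros and ones with the given bits. -/
def bitVec {d : ℕ} (v : Fin d → Bool) : Vec d := WithLp.toLp 2 fun j => if v j then 1 else 0

/-- The outputs that are read as the bits `v` by comparing each coordinate with `θ`. -/
def readsAs {d : ℕ} (θ : ℝ) (v : Fin d → Bool) : Set (Vec d) :=
  {y | ∀ j, v j = true ↔ θ < y j}

theorem readsAs_unique {d : ℕ} {θ : ℝ} {v v' : Fin d → Bool} {y : Vec d} (h : y ∈ readsAs θ v)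
    (h' : y ∈ readsAs θ v') : v = v' := by
  funext j
  exact Bool.eq_iff_iff.2 ((h j).trans (h' j).symm)

theorem toOuterMeasure_le_one {α : Type*} (p : PMF α) (s : Set α) : p.toOuterMeasure s ≤ 1 := by
  rw [← (PMF.toOuterMeasure_apply_eq_one_iff p p.support).2 le_rfl,
    ← p.toOuterMeasure_apply_inter_support s]
  exact MeasureTheory.measure_mono Set.inter_subset_right

/-- Two events of probability above `1 / 2` intersect. -/
theorem inter_nonempty_of_gt_half {α : Type*} (p : PMF α) {s t : Set α}
    (hs : 1 / 2 < p.toOuterMeasure s) (ht : 1 / 2 < p.toOuterMeasure t) : (s ∩ t).Nonempty := by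
  by_contra h
  have hdisj : Disjoint s t := Set.disjoint_iff_inter_eq_empty.2 (Set.not_nonempty_iff_eq_empty.1 h)
  have h1 : p.toOuterMeasure (s ∪ t) = p.toOuterMeasure s + p.toOuterMeasure t := by
    simp only [PMF.toOuterMeasure_apply]
    rw [Set.indicator_union_of_disjoint hdisj, ENNReal.tsum_add]
  have h2 := ENNReal.add_lt_add hs ht
  rw [← h1, ENNReal.add_halves] at h2
  exact absurd (toOuterMeasure_le_one p _) (not_le.2 h2)

/-- The entries of a stream that stores the word `v` of `N` symbols of `d` bits each: the first `N`
entries pair each symbol with its key, and all further entries are zero. -/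
def storeToken {d N : ℕ} (key : Fin N → Vec d) (v : Fin N → Fin d → Bool) (l : ℕ) : Token d where
  query := 0
  key := if h : l < N then key ⟨l, h⟩ else 0
  value := if h : l < N then bitVec (v ⟨l, h⟩) else 0

/-- The stream that stores `v` and then asks the query `q`. -/
def queryStream {d N k : ℕ} (key : Fin N → Vec d) (v : Fin N → Fin d → Bool) (q : Vec d) :
    Fin (k + 1) → Token d :=
  Fin.snoc (α := fun _ => Token d) (fun l : Fin k => storeToken key v l) ⟨q, 0, 0⟩

theorem ofFn_queryStream {d N k : ℕ} (key : Fin N → Vec d) (v : Fin N → Fin d → Bool) (q : Vec d) :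
    List.ofFn (queryStream (k := k) key v q) =
      List.ofFn (fun l : Fin k => storeToken key v l) ++ [⟨q, 0, 0⟩] := by
  rw [List.ofFn_succ', List.concat_eq_append]
  simp [queryStream]

/-- The output law on `queryStream` factors through the law of the memory before the query. -/
theorem outputProb_queryStream {d N k : ℕ} {σ : Type} (A : StreamAlg d σ) (key : Fin N → Vec d)
    (v : Fin N → Fin d → Bool) (q : Vec d) (good : Vec d → Prop) :
    A.outputProb (queryStream (k := k) key v q) good =
      ∑' s, ((A.run (List.ofFn fun l : Fin k => storeToken key v l)).map Prod.fst) s *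
        (A.step s ⟨q, 0, 0⟩).toOuterMeasure {y | good y.2} := by
  rw [StreamAlg.outputProb, ofFn_queryStream, A.run_append_singleton,
    ← PMF.toOuterMeasure_bind_apply, PMF.bind_map]
  rfl

theorem bitVec_mem_Icc {d : ℕ} (v : Fin d → Bool) (j : Fin d) :
    0 ≤ bitVec v j ∧ bitVec v j ≤ 1 := by
  simp only [bitVec]
  split_ifs <;> norm_num

theorem HasPrecision.bitVec {d b : ℕ} (v : Fin d → Bool) : HasPrecision b (bitVec v) := by
  refine HasPrecision.of_int (z := fun j => if v j then 1 else 0) (fun j => ?_) fun j => ?_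
  · have : (1 : ℤ) ≤ 2 ^ b := one_le_pow₀ (by norm_num)
    split_ifs
    · simpa using this
    · simp
  · simp only [KVCache.bitVec]
    split_ifs <;> simp

theorem storeToken_mem {d N b : ℕ} {key : Fin N → Vec d} (hkey : ∀ i, ‖key i‖ ≤ 1)
    (hprec : ∀ i, HasPrecision b (key i)) (v : Fin N → Fin d → Bool) (l : ℕ) :
    storeToken key v l ∈ preciseNonnegTokens d b := by
  by_cases h : l < N
  · simp only [storeToken, dif_pos h]
    exact ⟨⟨hkey _, HasPrecision.zero, hprec _, HasPrecision.bitVec _⟩,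
      fun j => (bitVec_mem_Icc _ j).1⟩
  · simp only [storeToken, dif_neg h]
    exact ⟨⟨by simp, HasPrecision.zero, HasPrecision.zero, HasPrecision.zero⟩, fun j => le_rfl⟩

theorem queryStream_castSucc {d N k : ℕ} (key : Fin N → Vec d) (v : Fin N → Fin d → Bool)
    (q : Vec d) (l : Fin k) :
    queryStream (k := k) key v q l.castSucc = storeToken key v l := by
  simp [queryStream]

theorem queryStream_last {d N k : ℕ} (key : Fin N → Vec d) (v : Fin N → Fin d → Bool)
    (q : Vec d) : queryStream (k := k) key v q (Fin.last k) = ⟨q, 0, 0⟩ := by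
  simp [queryStream]

theorem lastQuery_queryStream {d N k : ℕ} (hk : 0 < k + 1) (key : Fin N → Vec d)
    (v : Fin N → Fin d → Bool) (q : Vec d) :
    lastQuery hk (queryStream (k := k) key v q) = q := by
  have : (⟨k + 1 - 1, Nat.sub_lt hk one_pos⟩ : Fin (k + 1)) = Fin.last k := Fin.ext (by simp)
  rw [lastQuery, this, queryStream_last]

/-- If the query `q` prefers the key `i` by a wide margin, every accurate output reveals the symbol
stored under this key. -/
theorem isRelApprox_readsAs {d N k : ℕ} (hk : 0 < k + 1) (hNk : N ≤ k) {key : Fin N → Vec d}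
    (v : Fin N → Fin d → Bool) {q : Vec d} {i : Fin N} {g gap η : ℝ}
    (hgap : ((k + 1 : ℕ) : ℝ) * ((k + 1 : ℕ) : ℝ) ≤ Real.exp gap)
    (hself : inner ℝ q (key i) = g) (hg : gap ≤ g)
    (hother : ∀ i', i' ≠ i → inner ℝ q (key i') ≤ g - gap) (hη0 : 0 < η) (hη : η < 1)
    (hηk : 4 < (1 - η) * ((k + 1 : ℕ) : ℝ)) {y : Vec d}
    (hy : IsRelApprox η (lastAttn hk (queryStream (k := k) key v q)) y) :
    y ∈ readsAs (2 / ((k + 1 : ℕ) : ℝ)) (v i) := by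
  set n : ℝ := ((k + 1 : ℕ) : ℝ) with hn
  have hn0 : 0 < n := by rw [hn]; positivity
  set x := queryStream (k := k) key v q with hx
  set i₀ : Fin (k + 1) := Fin.castSucc ⟨i, i.2.trans_le hNk⟩ with hi₀
  have hstore : ∀ l : Fin k, x l.castSucc = storeToken key v l := fun l =>
    queryStream_castSucc key v q l
  have hlast : x (Fin.last k) = ⟨q, 0, 0⟩ := queryStream_last key v q
  have hkey₀ : (x i₀).key = key i := by
    rw [hi₀, hstore]; simp [storeToken]
  have hval₀ : (x i₀).value = bitVec (v i) := by
    rw [hi₀, hstore]; simp [storeToken]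
  have hw : ∀ l, l ≠ i₀ → n * (n * keyWeight q (x l).key) ≤ keyWeight q (x i₀).key := by
    intro l hl
    have hle : inner ℝ q (x l).key ≤ g - gap := by
      induction l using Fin.lastCases with
      | last => rw [hlast]; simpa using hg
      | cast l =>
        rw [hstore]
        by_cases h : (l : ℕ) < N
        · simp only [storeToken, dif_pos h]
          refine hother _ fun hli => hl ?_
          rw [hi₀, ← hli]
        · simp only [storeToken, dif_neg h, inner_zero_right]
          linarith
    rw [hkey₀, keyWeight, keyWeight, hself, ← mul_assoc]
    calc n * n * Real.exp (inner ℝ q (x l).key) ≤ Real.exp gap * Real.exp (g - gap) :=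
          mul_le_mul hgap (Real.exp_le_exp.2 hle) (Real.exp_pos _).le (Real.exp_pos _).le
      _ = Real.exp g := by rw [← Real.exp_add]; congr 1; ring
  have hv : ∀ l j, 0 ≤ (x l).value j ∧ (x l).value j ≤ 1 := by
    intro l j
    induction l using Fin.lastCases with
    | last => rw [hlast]; simp
    | cast l =>
      rw [hstore]
      by_cases h : (l : ℕ) < N
      · simp only [storeToken, dif_pos h]
        exact bitVec_mem_Icc _ j
      · simp [storeToken, dif_neg h]
  intro j
  obtain ⟨h1, h0⟩ := attn_bounds q x i₀ hv hw j
  have hy := hy j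
  rw [lastAttn, hx, lastQuery_queryStream, ← hx] at hy
  set z := attn q (keyMatrix x) (valueMatrix x) j
  obtain ⟨hy1, hy2⟩ := abs_le.1 hy
  rw [hval₀] at h1 h0
  constructor
  · intro hvj
    have hz := h1 (by simp [bitVec, hvj])
    rw [div_lt_iff₀ hn0]
    have h2 : (1 - η) * (1 / 2) ≤ y j := by nlinarith
    nlinarith
  · intro hθ
    by_contra hvj
    have hz := h0 (by simp [bitVec, hvj])
    have hz0 : 0 ≤ z := by
      have : 0 ≤ η * z := (abs_nonneg _).trans hy
      exact nonneg_of_mul_nonneg_right this hη0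
    have h2 : y j ≤ 2 * (1 / n) := by nlinarith
    rw [mul_one_div] at h2
    linarith

/-- The lower bound at a fixed length of the stream, with `2 ^ d * L` as the scale of the
queries. -/
theorem streamAlg_bits_ge {d k b L : ℕ} (hd : 2 ≤ d) (hk : 0 < k + 1) (hNk : 8 ^ (d / 2) ≤ k)
    (hL : ((k + 1 : ℕ) : ℝ) * ((k + 1 : ℕ) : ℝ) ≤ Real.exp L)
    (hLb : 2 * 2 ^ d * L ≤ k + 1) (hL1 : 1 ≤ L) (hb : k + 1 ≤ 2 ^ b) {η : ℝ} (hη0 : 0 < η)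
    (hη : η < 1) (hηk : 4 < (1 - η) * ((k + 1 : ℕ) : ℝ)) {σ : Type} (A : StreamAlg d σ) {B : ℕ}
    (hB : A.UsesBits (k + 1) (preciseNonnegTokens d b) B)
    (hA : ∀ x : Fin (k + 1) → Token d, (∀ l, x l ∈ preciseNonnegTokens d b) →
      9 / 10 ≤ A.outputProb x (IsRelApprox η (lastAttn hk x))) :
    4 * (d * 8 ^ (d / 2)) ≤ 5 * (B + 8 ^ (d / 2)) := by
  obtain ⟨u, S, hS1, hS4, hu, huu, huu'⟩ := exists_integer_vectors hd
  obtain ⟨enc, henc⟩ := hB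
  set key : Fin (8 ^ (d / 2)) → Vec d := fun i => WithLp.toLp 2 fun j => (u i j : ℝ) / 2 ^ d
    with hkeydef
  set q : Fin (8 ^ (d / 2)) → Vec d := fun i => WithLp.toLp 2 fun j => (2 ^ d * L * u i j : ℝ)
    with hqdef
  have hinner : ∀ i i', inner ℝ (q i) (key i') = (L : ℝ) * ((∑ j, u i j * u i' j : ℤ) : ℝ) := by
    intro i i'
    rw [EuclideanSpace.inner_eq_star_dotProduct]
    simp only [hqdef, hkeydef, dotProduct, Pi.star_apply, star_trivial]
    push_cast
    rw [Finset.mul_sum]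
    refine Finset.sum_congr rfl fun j _ => ?_
    field_simp
  have hkey1 : ∀ i, ‖key i‖ ≤ 1 := by
    intro i
    rw [← sq_le_one_iff₀ (norm_nonneg _), EuclideanSpace.norm_sq_eq]
    have h1 : ∑ j, ‖key i j‖ ^ 2 = (S : ℝ) / 4 ^ d := by
      rw [← huu i]
      push_cast
      rw [Finset.sum_div]
      refine Finset.sum_congr rfl fun j _ => ?_
      simp only [hkeydef, Real.norm_eq_abs, sq_abs, div_pow]
      rw [← pow_mul, mul_comm d 2, pow_mul, sq]
      norm_num
    rw [h1, div_le_one (by positivity)]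
    exact_mod_cast hS4
  have h2d : 2 * 2 ^ d ≤ k + 1 := (Nat.le_mul_of_pos_right _ hL1).trans hLb
  have hdb : d + 1 ≤ b := by
    rw [← Nat.pow_le_pow_iff_right one_lt_two, pow_succ, mul_comm]
    exact h2d.trans hb
  have hkeyp : ∀ i, HasPrecision b (key i) := by
    refine fun i j => ⟨u i j * 2 ^ (b - d), ?_, ?_⟩
    · rw [abs_mul, abs_of_pos (by positivity : (0 : ℤ) < 2 ^ (b - d))]
      calc |u i j| * 2 ^ (b - d) ≤ 2 * 2 ^ (b - d) :=
            mul_le_mul_of_nonneg_right (hu i j) (by positivity)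
        _ = 2 ^ (b - d + 1) := by rw [pow_succ, mul_comm]
        _ ≤ 2 ^ (2 * b) := pow_le_pow_right₀ (by norm_num) (by omega)
        _ = 4 ^ b := by rw [pow_mul]; norm_num
    · simp only [hkeydef]
      push_cast
      have h1 : (2 : ℝ) ^ b = 2 ^ (b - d) * 2 ^ d := by
        rw [← pow_add]; congr 1; omega
      rw [h1]
      field_simp
  have hqp : ∀ i, HasPrecision b (q i) := by
    refine fun i => HasPrecision.of_int (z := fun j => 2 ^ d * L * u i j) (fun j => ?_) fun j => ?_
    · rw [abs_mul, abs_of_nonneg (by positivity : (0 : ℤ) ≤ 2 ^ d * L)]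
      calc 2 ^ d * (L : ℤ) * |u i j| ≤ 2 ^ d * L * 2 :=
            mul_le_mul_of_nonneg_left (hu i j) (by positivity)
        _ = 2 * 2 ^ d * L := by ring
        _ ≤ 2 ^ b := by exact_mod_cast hLb.trans hb
    · simp only [hqdef]
      push_cast
      ring
  have hstore : ∀ v l, storeToken key v l ∈ preciseNonnegTokens d b := storeToken_mem hkey1 hkeyp
  have hstream : ∀ v i l, queryStream (k := k) key v (q i) l ∈ preciseNonnegTokens d b := by
    intro v i l
    induction l using Fin.lastCases with
    | last =>
      rw [queryStream_last]
      exact ⟨⟨by simp, hqp i, HasPrecision.zero, HasPrecision.zero⟩, fun j => le_rfl⟩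
    | cast l => rw [queryStream_castSucc]; exact hstore v l
  refine mul_le_of_index (X := Fin d → Bool) (by simp)
    (fun v => (A.run (List.ofFn fun l : Fin k => storeToken key v l)).map Prod.fst)
    (R := A.reachable (k + 1) (preciseNonnegTokens d b)) ?_ henc
    (fun s i w => (A.step s ⟨q i, 0, 0⟩).toOuterMeasure
      {y | y.2 ∈ readsAs (2 / ((k + 1 : ℕ) : ℝ)) w})
    (fun s i w => toOuterMeasure_le_one _ _) ?_ ?_
  · intro v s hs
    rw [PMF.support_map] at hs
    obtain ⟨⟨s', y⟩, hy, rfl⟩ := hs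
    refine ⟨_, by simp, fun a ha => ?_, y, hy⟩
    obtain ⟨l, rfl⟩ := (List.mem_ofFn' _ _).1 ha
    exact hstore v l
  · intro s i w w' h h'
    obtain ⟨y, hy, hy'⟩ := inter_nonempty_of_gt_half _ h h'
    exact readsAs_unique hy hy'
  · intro v i
    rw [← outputProb_queryStream A key v (q i) fun y =>
      y ∈ readsAs (2 / ((k + 1 : ℕ) : ℝ)) (v i)]
    refine (hA _ (hstream v i)).trans (MeasureTheory.measure_mono fun y hy => ?_)
    have hL0 : (0 : ℝ) ≤ L := Nat.cast_nonneg L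
    refine isRelApprox_readsAs hk hNk v (i := i) (g := L * S) (gap := L) hL ?_ ?_ ?_ hη0 hη hηk hy
    · rw [hinner, huu]
    · refine le_mul_of_one_le_right hL0 ?_
      exact_mod_cast hS1
    · intro i' hi'
      rw [hinner]
      have h1 : ((∑ j, u i j * u i' j : ℤ) : ℝ) ≤ S - 1 := by
        exact_mod_cast huu' i i' hi'.symm
      calc (L : ℝ) * ((∑ j, u i j * u i' j : ℤ) : ℝ) ≤ L * (S - 1) :=
            mul_le_mul_of_nonneg_left h1 hL0
        _ = L * S - L := by ring

theorem exp_le_eight_pow_half (d : ℕ) : Real.exp d ≤ Real.exp 1 * 8 ^ (d / 2) := by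
  have h1 : d ≤ 1 + 2 * (d / 2) := by omega
  have h2 : (d : ℝ) ≤ 1 + (d / 2 : ℕ) * 2 := by
    have : (d : ℝ) ≤ ((1 + 2 * (d / 2) : ℕ) : ℝ) := by exact_mod_cast h1
    push_cast at this
    linarith
  have h3 : Real.exp 2 ≤ 8 := by
    have : Real.exp 2 = Real.exp 1 ^ 2 := by rw [← Real.exp_nat_mul]; norm_num
    rw [this]
    nlinarith [Real.exp_one_lt_d9, Real.exp_pos 1]
  calc Real.exp d ≤ Real.exp (1 + (d / 2 : ℕ) * 2) := Real.exp_le_exp.2 h2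
    _ = Real.exp 1 * Real.exp 2 ^ (d / 2) := by rw [Real.exp_add, Real.exp_nat_mul]
    _ ≤ Real.exp 1 * 8 ^ (d / 2) := by gcongr

theorem le_of_four_mul_le {d B : ℕ} (hd : 2 ≤ d)
    (h : 4 * (d * 8 ^ (d / 2)) ≤ 5 * (B + 8 ^ (d / 2))) :
    1 / 10 * (d * Real.exp d) ≤ B := by
  have h1 : (4 * (d * 8 ^ (d / 2)) : ℝ) ≤ 5 * (B + 8 ^ (d / 2)) := by exact_mod_cast h
  have h2 := exp_le_eight_pow_half d
  have hd2 : (2 : ℝ) ≤ d := by exact_mod_cast hd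
  set N : ℝ := 8 ^ (d / 2)
  have hN : 0 < N := by positivity
  have h3 : Real.exp d ≤ 3 * N := h2.trans (by nlinarith [Real.exp_one_lt_three])
  have h4 : (d : ℝ) * Real.exp d ≤ d * (3 * N) := by gcongr
  have h5 : 2 * N ≤ d * N := by gcongr
  nlinarith

/-- The size conditions of `streamAlg_bits_ge` when `d` is small compared to `log n`. -/
theorem size_conditions {n d : ℕ} (hn : 10 ≤ Real.log n) (hd : (d : ℝ) ≤ Real.log n / 8) :
    8 ^ (d / 2) + 1 ≤ n ∧ (n : ℝ) * n ≤ Real.exp ⌈2 * Real.log n⌉₊ ∧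
      2 * 2 ^ d * ⌈2 * Real.log n⌉₊ ≤ n := by
  set y := Real.log n with hy
  have hn0 : (0 : ℝ) < n := by
    rcases Nat.eq_zero_or_pos n with rfl | h
    · simp [hy] at hn; norm_num at hn
    · exact_mod_cast h
  have hexp : Real.exp y = n := Real.exp_log hn0
  have he2 : 2 ≤ Real.exp 1 := by linarith [Real.exp_one_gt_d9]
  have h4 : (4 : ℝ) ≤ Real.exp 2 := by
    have : Real.exp 2 = Real.exp 1 ^ 2 := by rw [← Real.exp_nat_mul]; norm_num
    rw [this]; nlinarith
  have h32 : (32 : ℝ) ≤ Real.exp 5 := by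
    have : Real.exp 5 = Real.exp 1 ^ 5 := by rw [← Real.exp_nat_mul]; norm_num
    rw [this]
    calc (32 : ℝ) = 2 ^ 5 := by norm_num
      _ ≤ _ := pow_le_pow_left₀ (by norm_num) he2 5
  refine ⟨?_, ?_, ?_⟩
  · have h1 : (8 ^ (d / 2) : ℝ) ≤ Real.exp (y / 4) := by
      calc (8 ^ (d / 2) : ℝ) ≤ 16 ^ (d / 2) := by gcongr; norm_num
        _ = 4 ^ (2 * (d / 2)) := by rw [pow_mul]; norm_num
        _ ≤ 4 ^ d := pow_le_pow_right₀ (by norm_num) (by omega)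
        _ ≤ Real.exp 2 ^ d := by gcongr
        _ = Real.exp (d * 2) := (Real.exp_nat_mul _ _).symm
        _ ≤ Real.exp (y / 4) := Real.exp_le_exp.2 (by linarith)
    have h2 : Real.exp (y / 4) * 2 ≤ n := by
      rw [← hexp]
      calc Real.exp (y / 4) * 2 ≤ Real.exp (y / 4) * Real.exp 1 := by gcongr
        _ = Real.exp (y / 4 + 1) := (Real.exp_add _ _).symm
        _ ≤ Real.exp y := Real.exp_le_exp.2 (by linarith)
    have h3 : 1 ≤ Real.exp (y / 4) := Real.one_le_exp (by linarith)
    have h5 : (8 ^ (d / 2) + 1 : ℝ) ≤ n := by linarith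
    exact_mod_cast h5
  · rw [← hexp, ← Real.exp_add]
    refine Real.exp_le_exp.2 ?_
    have := Nat.le_ceil (2 * y)
    linarith
  · have h1 : ((2 : ℝ) ^ d) ≤ Real.exp (y / 8) := by
      calc (2 : ℝ) ^ d ≤ Real.exp 1 ^ d := by gcongr
        _ = Real.exp d := Real.exp_one_pow d
        _ ≤ _ := Real.exp_le_exp.2 hd
    have h2 : (⌈2 * y⌉₊ : ℝ) ≤ 12 * Real.exp (y / 4) := by
      have h3 := (Nat.ceil_lt_add_one (by linarith : 0 ≤ 2 * y)).le
      have h5 := Real.add_one_le_exp (y / 4)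
      linarith
    have h3 : (2 * 2 ^ d * ⌈2 * y⌉₊ : ℝ) ≤ n := by
      calc (2 * 2 ^ d * ⌈2 * y⌉₊ : ℝ) ≤ 2 * Real.exp (y / 8) * (12 * Real.exp (y / 4)) := by gcongr
        _ = 24 * Real.exp (y / 8 + y / 4) := by rw [Real.exp_add]; ring
        _ ≤ Real.exp 5 * Real.exp (y / 2) := by
            refine mul_le_mul (by linarith) (Real.exp_le_exp.2 (by linarith)) (Real.exp_pos _).le
              (Real.exp_pos _).le
        _ = Real.exp (5 + y / 2) := (Real.exp_add _ _).symm
        _ ≤ Real.exp y := Real.exp_le_exp.2 (by linarith)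
        _ = n := hexp
    exact_mod_cast h3

theorem streamAlg_lower_bound : ∃ c : ℝ, 0 < c ∧
      ∀ η : ℝ, 0 < η → η < 1 →
      ∀ d : ℕ → ℕ, (∀ n, 2 ≤ d n) →
        ((fun n => (d n : ℝ)) =o[atTop] fun n : ℕ => Real.log n) →
      ∀ᶠ n : ℕ in atTop, ∀ hn : 0 < n, ∀ b : ℕ, n ≤ 2 ^ b →
      ∀ (σ : Type) (A : StreamAlg (d n) σ) (B : ℕ),
        A.UsesBits n (preciseNonnegTokens (d n) b) B →
        (∀ x : Fin n → Token (d n),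
          (∀ l, x l ∈ preciseNonnegTokens (d n) b) →
          9 / 10 ≤ A.outputProb x (IsRelApprox η (lastAttn hn x))) →
        c * (d n * Real.exp (d n)) ≤ B := by
  refine ⟨1 / 10, by norm_num, fun η hη0 hη d hd hdo => ?_⟩
  have hlog : Tendsto (fun n : ℕ => Real.log n) atTop atTop :=
    Real.tendsto_log_atTop.comp tendsto_natCast_atTop_atTop
  have hηn : Tendsto (fun n : ℕ => (1 - η) * (n : ℝ)) atTop atTop :=
    tendsto_natCast_atTop_atTop.const_mul_atTop (by linarith)
  filter_upwards [hlog.eventually_ge_atTop 10, hηn.eventually_gt_atTop 4,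
    hdo.bound (by norm_num : (0 : ℝ) < 1 / 8)] with n hn10 hηn hdn hn b hb σ A B hB hA
  rw [Real.norm_of_nonneg (Nat.cast_nonneg _), Real.norm_of_nonneg (by linarith)] at hdn
  obtain ⟨hN, hL, hLb⟩ := size_conditions (d := d n) hn10 (by linarith)
  have hL1 : 1 ≤ ⌈2 * Real.log n⌉₊ := Nat.one_le_iff_ne_zero.2
    (Nat.ceil_pos.2 (by linarith)).ne'
  have hd2 := hd n
  generalize d n = D at *
  obtain ⟨k, rfl⟩ := Nat.exists_eq_add_one_of_ne_zero hn.ne'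
  exact le_of_four_mul_le hd2 (streamAlg_bits_ge hd2 hn (Nat.le_of_succ_le_succ hN) hL hLb hL1 hb
    hη0 hη hηn A hB hA)

end KVCache

end

theorem mainTheorem5 :
    -- upper bound: accuracy and space of SubGen with threshold `δ = e / 3`
    (∃ a : ℝ, 0 < a ∧
      ∀ r : ℕ → ℝ, (r =O[atTop] fun n : ℕ => Real.log (Real.log n)) →
      ∃ (C : ℝ) (c : ℕ),
      ∀ d : ℕ → ℕ, (∀ n, 2 ≤ d n) →
        ((fun n => (d n : ℝ)) =o[atTop] fun n : ℕ => Real.log n) →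
      ∀ᶠ n : ℕ in atTop, ∀ ε : ℝ, 0 < ε → ε < 1 →
        -- accuracy, at every time step
        (∀ (i : ℕ) (hi : 0 < i), i ≤ n → ∀ x : Fin i → KVCache.Token (d n),
          (∀ l, ‖(x l).key‖ ≤ 1) → (∀ l, ‖(x l).query‖ ≤ r n) →
          99 / 100 ≤ (KVCache.tunedSubGen a ε (Real.exp 1 / 3) (r n) n (d n)).outputProb x
            (KVCache.IsSpectralApprox ε hi x)) ∧
        -- space in words, for real inputs
        (∀ σ ∈ (KVCache.tunedSubGen a ε (Real.exp 1 / 3) (r n) n (d n)).reachable n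
            {x | ‖x.key‖ ≤ 1},
          (σ.words : ℝ) ≤ C * (ε ^ 2)⁻¹ * (d n * Real.exp (d n)) * Real.log n ^ c) ∧
        -- space in bits, for `b`-bit inputs
        (∀ b : ℕ, ∃ B : ℕ,
          (B : ℝ) ≤ (b + 1) * (C * (ε ^ 2)⁻¹ * (d n * Real.exp (d n)) * Real.log n ^ c) ∧
          (KVCache.tunedSubGen a ε (Real.exp 1 / 3) (r n) n (d n)).UsesBits n
            (KVCache.preciseTokens (d n) b) B)) ∧
    -- lower bound for all randomized streaming algorithms
    (∃ c : ℝ, 0 < c ∧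
      ∀ η : ℝ, 0 < η → η < 1 →
      ∀ d : ℕ → ℕ, (∀ n, 2 ≤ d n) →
        ((fun n => (d n : ℝ)) =o[atTop] fun n : ℕ => Real.log n) →
      ∀ᶠ n : ℕ in atTop, ∀ hn : 0 < n, ∀ b : ℕ, n ≤ 2 ^ b →
      ∀ (σ : Type) (A : KVCache.StreamAlg (d n) σ) (B : ℕ),
        A.UsesBits n (KVCache.preciseNonnegTokens (d n) b) B →
        (∀ x : Fin n → KVCache.Token (d n),
          (∀ l, x l ∈ KVCache.preciseNonnegTokens (d n) b) →
          9 / 10 ≤ A.outputProb x (KVCache.IsRelApprox η (KVCache.lastAttn hn x))) →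
        c * (d n * Real.exp (d n)) ≤ B) := by
  obtain ⟨a, ha, h⟩ := KVCache.tunedSubGen_upper_bound
  refine ⟨⟨a, ha, fun r hr => ?_⟩, KVCache.streamAlg_lower_bound⟩
  obtain ⟨C, c, hC⟩ := h r hr
  exact ⟨C, c, fun d hd _ => hC d hd⟩
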